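/- **Graphs.** A graph is finite, connected, directed, has at least one edge, no self-loops and no multiple edges; an edge $e$ goes from $e^-$ to $e^+$. Paths ignore the orientation of edges. An $s$-$t$ graph $G$ is a graph with two distinct vertices, a source $s(G)$ and a sink $t(G)$, such that every vertex lies on a directed path from $s(G)$ to $t(G)$. For $s$-$t$ graphs $H,G$, the $s$-$t$ graph $H\oslash G$ is obtained by replacing every edge $e$ of $H$ by a copy $e\oslash G$ of $G$, the source and the sink of this copy being identified with $e^-$ and $e^+$; its source and sink are those of $H$. Put $G^{\oslash 1}=G$ and $G^{\oslash (n+1)}=G^{\oslash n}\oslash G$. For integers $k,m\ge 2$, the diamond graph $\mathsf D_{k,m}$ is the $s$-$t$ graph that consists of $m$ directed paths of length $k$ with a common first vertex (the source) and a common last vertex (the sink), and no other vertices in common. **Isoperimetric dimension.** Let $\mu$ be a probability measure on the vertex set $V(G)$, $\nu$ a probability measure on the edge set $E(G)$, $\mathsf d$ a geodesic metric on $V(G)$ (any two vertices $x,y$ are joined by a path $x=u_0,\dots,u_r=y$ with $\mathsf d(x,y)=\sum_{i=1}^r\mathsf d(u_{i-1},u_i)$), $\delta\in[1,\infty)$ and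 $C\in(0,\infty)$. The graph $G$ has $(\mu,\nu,\mathsf d)$-isoperimetric dimension $\delta$ with constant $C$ if for every $A\subset V(G)$ $$\min\{\mu(A),\mu(A^c)\}^{\frac{\delta-1}{\delta}}\le C\sum_{e\in\partial A}\frac{\nu(e)}{\mathsf d(e^-,e^+)},$$ where $\partial A$ is the set of edges with exactly one endpoint in $A$. **Lipschitz-spectral profile.** Let $\mu$ be a probability measure and $\mathsf d$ a metric on $V(G)$, $\delta,\beta\in[1,\infty)$ and $C_1,C_\infty,C_\gamma\in(0,\infty)$. The graph $G$ has $(\mu,\mathsf d)$-Lipschitz-spectral profile of dimension $\delta$ and bandwidth $\beta$ with constants $C_1,C_\infty,C_\gamma$ if there is a family of functions $f_i\colon V(G)\to\mathbb R$, $i\in I$, pairwise orthogonal in $L_2(\mu)$, with $\|f_i\|_{L_1(\mu)}\ge C_1^{-1}$ and $\|f_i\|_{L_\infty(\mu)}\le C_\infty$ for every $i\in I$, and with $|\{i\in I:\operatorname{Lip}(f_i)\le s\}|\ge C_\gamma^{-1}s^\delta$ for every $s\in[1,\beta]$, where $\operatorname{Lip}$ is the Lipschitz constant with respect to $\mathsf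 d$. **Theorem C.** Let $k,m\ge 2$ be integers. There are constants $C_{iso}\le\frac m2$, $C_1\le 6$, $C_\infty\le 1$ and $C_\gamma\le 2k^2m^2$ such that the following holds for every integer $n\ge 1$. Equip $\mathsf D_{k,m}^{\oslash n}$ with the shortest path metric $\mathsf d$ in which every edge has length $k^{-n}$, with the degree-probability measure $\mu(x)=\frac{\deg(x)}{2|E|}$ on its vertices, and with the uniform probability measure $\nu$ on its edge set $E$. Then $\mathsf D_{k,m}^{\oslash n}$ has $(\mu,\nu,\mathsf d)$-isoperimetric dimension $1+\frac{\log m}{\log k}$ with constant $C_{iso}$, and $(\mu,\mathsf d)$-Lipschitz-spectral profile of dimension $1+\frac{\log m}{\log k}$ and bandwidth $k^n$ with constants $C_1,C_\infty,C_\gamma$. -/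

import Mathlib

noncomputable section

open scoped ENNReal

/-! # Graphs and s-t graphs -/

/-- The undirected simple graph obtained by forgetting the orientation of the edges. -/
def underlyingGraph {V E : Type} (src tgt : E → V) : SimpleGraph V :=
  SimpleGraph.fromRel fun u v => ∃ e, src e = u ∧ tgt e = v

/-- A finite connected directed graph with at least one edge, without self-loops and with at most
one edge between two vertices. An edge `e` is directed from `e⁻ = src e` to `e⁺ = tgt e`, and is
determined by its endpoints. -/
structure DirGraph where
  V : Type
  E : Type
  fintypeV : Fintype V
  fintypeE : Fintype E
  src : E → V
  tgt : E → V
  nonempty_edge : Nonempty E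
  loopless : ∀ e, src e ≠ tgt e
  edge_unique : ∀ e f, s(src e, tgt e) = s(src f, tgt f) → e = f
  connected : (underlyingGraph src tgt).Connected

attribute [instance] DirGraph.fintypeV DirGraph.fintypeE DirGraph.nonempty_edge

namespace DirGraph

/-- The undirected graph of `G`; its walks are the paths of `G`. -/
abbrev toSimple (G : DirGraph) : SimpleGraph G.V := underlyingGraph G.src G.tgt

theorem toSimple_connected (G : DirGraph) : G.toSimple.Connected := G.connected

/-- There is a directed edge from `u` to `v`. -/
def DirAdj (G : DirGraph) (u v : G.V) : Prop := ∃ e, G.src e = u ∧ G.tgt e = v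

/-- There is a directed path from `u` to `v`. -/
def DirPath (G : DirGraph) (u v : G.V) : Prop := Relation.ReflTransGen G.DirAdj u v

end DirGraph

/-- An s-t graph: a graph with two distinct vertices, the source `s` and the sink `t`, such that
every vertex lies on a directed path from `s` to `t`. -/
structure STGraph extends DirGraph where
  s : V
  t : V
  s_ne_t : s ≠ t
  path_from_s : ∀ x, toDirGraph.DirPath s x
  path_to_t : ∀ x, toDirGraph.DirPath x t

/-! # The slash product -/

/-- The relation on `E(H) × V(G)` that glues the copies of `G`: the source and the sink of the copy
of `G` indexed by the edge `e` of `H` are identified with `e⁻` and `e⁺`. -/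
def slashSetoid (H : DirGraph) (G : STGraph) : Setoid (H.E × G.V) where
  r p q := p = q ∨
    (H.tgt p.1 = H.src q.1 ∧ p.2 = G.t ∧ q.2 = G.s) ∨
    (H.src p.1 = H.tgt q.1 ∧ p.2 = G.s ∧ q.2 = G.t) ∨
    (H.tgt p.1 = H.tgt q.1 ∧ p.2 = G.t ∧ q.2 = G.t) ∨
    (H.src p.1 = H.src q.1 ∧ p.2 = G.s ∧ q.2 = G.s)
  iseqv := by
    have := G.s_ne_t
    refine ⟨?_, ?_, ?_⟩
    · intro x; exact Or.inl rfl
    · intro x y; grind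
    · intro x y z; grind

/-- The vertex set of the slash product. -/
abbrev SlashV (H : DirGraph) (G : STGraph) : Type := Quotient (slashSetoid H G)

/-- The vertex `e ⊘ u` of the slash product. -/
def slashMk {H : DirGraph} {G : STGraph} (e : H.E) (u : G.V) : SlashV H G :=
  Quotient.mk (slashSetoid H G) (e, u)

theorem slashMk_eq_iff {H : DirGraph} {G : STGraph} {e f : H.E} {u v : G.V} :
    slashMk e u = slashMk f v ↔ (e = f ∧ u = v) ∨
      (H.tgt e = H.src f ∧ u = G.t ∧ v = G.s) ∨
      (H.src e = H.tgt f ∧ u = G.s ∧ v = G.t) ∨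
      (H.tgt e = H.tgt f ∧ u = G.t ∧ v = G.t) ∨
      (H.src e = H.src f ∧ u = G.s ∧ v = G.s) := by
  have h : slashMk e u = slashMk f v ↔ ((e, u) = (f, v) ∨
      (H.tgt e = H.src f ∧ u = G.t ∧ v = G.s) ∨
      (H.src e = H.tgt f ∧ u = G.s ∧ v = G.t) ∨
      (H.tgt e = H.tgt f ∧ u = G.t ∧ v = G.t) ∨
      (H.src e = H.src f ∧ u = G.s ∧ v = G.s)) := Quotient.eq
  rw [h, Prod.mk.injEq]

theorem slashMk_inj {H : DirGraph} {G : STGraph} {e : H.E} {u v : G.V}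
    (h : slashMk e u = slashMk e v) : u = v := by
  have := H.loopless e
  rw [slashMk_eq_iff] at h
  grind

theorem underlyingGraph_reachable {V E : Type} (src tgt : E → V) (e : E) :
    (underlyingGraph src tgt).Reachable (src e) (tgt e) := by
  by_cases h : src e = tgt e
  · rw [h]
  · exact SimpleGraph.Adj.reachable ⟨h, Or.inl ⟨e, rfl, rfl⟩⟩

theorem slash_edge_unique (H : DirGraph) (G : STGraph) (p q : H.E × G.E)
    (h : s((slashMk p.1 (G.src p.2) : SlashV H G), slashMk p.1 (G.tgt p.2)) =
      s((slashMk q.1 (G.src q.2) : SlashV H G), slashMk q.1 (G.tgt q.2))) : p = q := by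
  obtain ⟨e, f⟩ := p
  obtain ⟨e', f'⟩ := q
  have h1 := G.loopless f
  have h2 := G.loopless f'
  have h3 := H.loopless e
  have h4 := H.loopless e'
  have h5 := H.edge_unique e e'
  have h6 := G.edge_unique f f'
  have h7 := G.s_ne_t
  simp only [Sym2.eq_iff, slashMk_eq_iff] at h h5 h6
  grind

theorem slash_connected (H : DirGraph) (G : STGraph) :
    (underlyingGraph (fun p : H.E × G.E => (slashMk p.1 (G.src p.2) : SlashV H G))
      (fun p => slashMk p.1 (G.tgt p.2))).Connected := by
  set U := underlyingGraph (fun p : H.E × G.E => (slashMk p.1 (G.src p.2) : SlashV H G))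
      (fun p => slashMk p.1 (G.tgt p.2)) with hU
  have copyAdj : ∀ (e : H.E) (f : G.E),
      U.Reachable (slashMk e (G.src f)) (slashMk e (G.tgt f)) := fun e f =>
    underlyingGraph_reachable (fun p : H.E × G.E => (slashMk p.1 (G.src p.2) : SlashV H G))
      (fun p => slashMk p.1 (G.tgt p.2)) (e, f)
  have copy : ∀ (e : H.E) (u v : G.V), U.Reachable (slashMk e u) (slashMk e v) := by
    intro e u v
    obtain ⟨w⟩ := G.connected u v
    induction w with
    | nil => exact SimpleGraph.Reachable.refl _
    | cons hadj _ ih =>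
      refine SimpleGraph.Reachable.trans ?_ ih
      obtain ⟨-, ⟨f, rfl, rfl⟩ | ⟨f, rfl, rfl⟩⟩ := hadj
      · exact copyAdj e f
      · exact (copyAdj e f).symm
  have share : ∀ (e f : H.E) (x : H.V), (H.src e = x ∨ H.tgt e = x) →
      (H.src f = x ∨ H.tgt f = x) → ∀ u v, U.Reachable (slashMk e u) (slashMk f v) := by
    intro e f x he hf u v
    have : ∃ a b, (slashMk e a : SlashV H G) = slashMk f b := by
      simp only [slashMk_eq_iff]
      grind
    obtain ⟨a, b, hab⟩ := this
    exact ((copy e u a).trans (hab ▸ SimpleGraph.Reachable.refl _)).trans (copy f b v)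
  have main : ∀ x y : H.V, ∀ e f : H.E, (H.src e = x ∨ H.tgt e = x) →
      (H.src f = y ∨ H.tgt f = y) → ∀ u v, U.Reachable (slashMk e u) (slashMk f v) := by
    intro x y
    obtain ⟨w⟩ := H.connected x y
    induction w with
    | nil => intro e f he hf u v; exact share e f _ he hf u v
    | cons hadj _ ih =>
      intro e f he hf u v
      obtain ⟨-, ⟨g, rfl, rfl⟩ | ⟨g, rfl, rfl⟩⟩ := hadj
      · exact (share e g _ he (Or.inl rfl) u u).trans (ih g f (Or.inr rfl) hf u v)
      · exact (share e g _ he (Or.inr rfl) u u).trans (ih g f (Or.inl rfl) hf u v)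
  have : Nonempty (SlashV H G) := ⟨slashMk H.nonempty_edge.some G.s⟩
  refine SimpleGraph.Connected.mk ?_
  intro a b
  induction a using Quotient.inductionOn with | _ p => ?_
  induction b using Quotient.inductionOn with | _ q => ?_
  exact main _ _ p.1 q.1 (Or.inl rfl) (Or.inl rfl) p.2 q.2

open Classical in
/-- The slash product `H ⊘ G`: every edge of `H` is replaced by a copy of `G`. Its edges are
`e ⊘ f`, directed from `e ⊘ f⁻` to `e ⊘ f⁺`, for `e` an edge of `H` and `f` an edge of `G`. -/
def DirGraph.slash (H : DirGraph) (G : STGraph) : DirGraph where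
  V := SlashV H G
  E := H.E × G.E
  fintypeV := inferInstance
  fintypeE := inferInstance
  src p := slashMk p.1 (G.src p.2)
  tgt p := slashMk p.1 (G.tgt p.2)
  nonempty_edge := inferInstance
  loopless p h := G.loopless p.2 (slashMk_inj h)
  edge_unique := slash_edge_unique H G
  connected := slash_connected H G

theorem STGraph.exists_src_eq_s (H : STGraph) : ∃ e, H.src e = H.s := by
  rcases Relation.ReflTransGen.cases_head (H.path_to_t H.s) with h | ⟨_, ⟨e, he, -⟩, -⟩
  · exact absurd h H.s_ne_t
  · exact ⟨e, he⟩

theorem STGraph.exists_tgt_eq_t (H : STGraph) : ∃ e, H.tgt e = H.t := by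
  rcases Relation.ReflTransGen.cases_tail (H.path_from_s H.t) with h | ⟨_, -, ⟨e, -, he⟩⟩
  · exact absurd h.symm H.s_ne_t
  · exact ⟨e, he⟩

/-- The source of `H ⊘ G`, that is, the source of `H` as a vertex of `H ⊘ G`. -/
def STGraph.slashS (H G : STGraph) : SlashV H.toDirGraph G :=
  slashMk (Classical.choose H.exists_src_eq_s) G.s

/-- The sink of `H ⊘ G`, that is, the sink of `H` as a vertex of `H ⊘ G`. -/
def STGraph.slashT (H G : STGraph) : SlashV H.toDirGraph G :=
  slashMk (Classical.choose H.exists_tgt_eq_t) G.t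

theorem STGraph.slashS_eq (H G : STGraph) {e : H.E} (he : H.src e = H.s) :
    H.slashS G = slashMk e G.s := by
  have h := Classical.choose_spec H.exists_src_eq_s
  simp only [slashS, slashMk_eq_iff, h, he]
  grind

theorem STGraph.slashT_eq (H G : STGraph) {e : H.E} (he : H.tgt e = H.t) :
    H.slashT G = slashMk e G.t := by
  have h := Classical.choose_spec H.exists_tgt_eq_t
  simp only [slashT, slashMk_eq_iff, h, he]
  grind

theorem slash_copy_path (H : DirGraph) (G : STGraph) (e : H.E) {u v : G.V}
    (h : G.DirPath u v) : (H.slash G).DirPath (slashMk e u) (slashMk e v) := by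
  induction h with
  | refl => exact Relation.ReflTransGen.refl
  | tail _ hbc ih =>
    obtain ⟨f, rfl, rfl⟩ := hbc
    exact ih.tail ⟨(e, f), rfl, rfl⟩

theorem slash_path (H : DirGraph) (G : STGraph) {x y : H.V} (h : H.DirPath x y) :
    ∀ p q : SlashV H G,
      ((∃ e, H.src e = x ∧ p = slashMk e G.s) ∨ (∃ e, H.tgt e = x ∧ p = slashMk e G.t)) →
      ((∃ e, H.src e = y ∧ q = slashMk e G.s) ∨ (∃ e, H.tgt e = y ∧ q = slashMk e G.t)) →
      (H.slash G).DirPath p q := by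
  have key : ∀ (z : H.V) (p q : SlashV H G),
      ((∃ e, H.src e = z ∧ p = slashMk e G.s) ∨ (∃ e, H.tgt e = z ∧ p = slashMk e G.t)) →
      ((∃ e, H.src e = z ∧ q = slashMk e G.s) ∨ (∃ e, H.tgt e = z ∧ q = slashMk e G.t)) →
      p = q := by
    rintro z p q (⟨e, h1, rfl⟩ | ⟨e, h1, rfl⟩) (⟨f, h2, rfl⟩ | ⟨f, h2, rfl⟩) <;>
      simp [slashMk_eq_iff, h1, h2]
  induction h using Relation.ReflTransGen.head_induction_on with
  | refl =>
    intro p q hp hq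
    rw [key y p q hp hq]
    exact Relation.ReflTransGen.refl
  | head hxz _ ih =>
    obtain ⟨e, rfl, rfl⟩ := hxz
    intro p q hp hq
    rw [key _ p (slashMk e G.s) hp (Or.inl ⟨e, rfl, rfl⟩)]
    exact (slash_copy_path H G e (G.path_from_s G.t)).trans
      (ih _ q (Or.inr ⟨e, rfl, rfl⟩) hq)

/-- The slash product of two s-t graphs as an s-t graph. -/
def STGraph.slash (H G : STGraph) : STGraph where
  toDirGraph := H.toDirGraph.slash G
  s := H.slashS G
  t := H.slashT G
  s_ne_t := by
    have h1 := Classical.choose_spec H.exists_src_eq_s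
    have h2 := Classical.choose_spec H.exists_tgt_eq_t
    have h3 := H.s_ne_t
    have h4 := G.s_ne_t
    intro h
    have h' := slashMk_eq_iff.mp h
    grind
  path_from_s x := by
    induction x using Quotient.inductionOn with | _ p => ?_
    obtain ⟨e, he⟩ := H.exists_src_eq_s
    rw [H.slashS_eq G he]
    exact (slash_path H.toDirGraph G (H.path_from_s (H.src p.1)) (slashMk e G.s) (slashMk p.1 G.s)
      (Or.inl ⟨e, he, rfl⟩) (Or.inl ⟨p.1, rfl, rfl⟩)).trans
      (slash_copy_path H.toDirGraph G p.1 (G.path_from_s p.2))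
  path_to_t x := by
    induction x using Quotient.inductionOn with | _ p => ?_
    obtain ⟨e, he⟩ := H.exists_tgt_eq_t
    rw [H.slashT_eq G he]
    exact (slash_copy_path H.toDirGraph G p.1 (G.path_to_t p.2)).trans
      (slash_path H.toDirGraph G (H.path_to_t (H.tgt p.1)) (slashMk p.1 G.t) (slashMk e G.t)
      (Or.inr ⟨p.1, rfl, rfl⟩) (Or.inr ⟨e, he, rfl⟩))

/-- The slash power `G^{⊘ n}` for `n ≥ 1`: `G^{⊘ 1} = G` and `G^{⊘ (n + 1)} = G^{⊘ n} ⊘ G`.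
The value at `n = 0` is a placeholder. -/
def STGraph.slashPow (G : STGraph) : ℕ → STGraph
  | 0 => G
  | 1 => G
  | n + 2 => (G.slashPow (n + 1)).slash G

/-! # Generalized diamond graphs -/

/-- The identification of the `m` starting points and of the `m` end points of `m` disjoint copies
of the path of length `k`; the vertex `i / k` of the path is written as `i`. -/
def diamondSetoid (k m : ℕ) : Setoid (Fin (k + 1) × Fin m) where
  r p q := p = q ∨ (p.1 = 0 ∧ q.1 = 0) ∨ (p.1 = Fin.last k ∧ q.1 = Fin.last k)
  iseqv := by
    refine ⟨?_, ?_, ?_⟩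
    · intro x; exact Or.inl rfl
    · intro x y; grind
    · intro x y z; grind

/-- The vertex set of the diamond graph. -/
abbrev DiamondV (k m : ℕ) : Type := Quotient (diamondSetoid k m)

/-- The class of the vertex `u` of the `i`-th path. -/
def diamondMk {k m : ℕ} (u : Fin (k + 1)) (i : Fin m) : DiamondV k m :=
  Quotient.mk (diamondSetoid k m) (u, i)

theorem diamondMk_eq_iff {k m : ℕ} {u v : Fin (k + 1)} {i j : Fin m} :
    diamondMk u i = diamondMk v j ↔
      (u = v ∧ i = j) ∨ (u = 0 ∧ v = 0) ∨ (u = Fin.last k ∧ v = Fin.last k) := by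
  have h : diamondMk u i = diamondMk v j ↔ ((u, i) = (v, j) ∨
      (u = 0 ∧ v = 0) ∨ (u = Fin.last k ∧ v = Fin.last k)) := Quotient.eq
  rw [h, Prod.mk.injEq]

theorem diamond_path {k m : ℕ} (i : Fin m) {u v : Fin (k + 1)} (huv : u ≤ v) :
    Relation.ReflTransGen (fun a b : DiamondV k m => ∃ e : Fin k × Fin m,
      diamondMk e.1.castSucc e.2 = a ∧ diamondMk e.1.succ e.2 = b)
      (diamondMk u i) (diamondMk v i) := by
  induction v using Fin.induction with
  | zero =>
    rw [Fin.le_zero_iff.mp huv]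
  | succ j ih =>
    rcases huv.lt_or_eq with h | h
    · exact (ih (Fin.le_castSucc_iff.mpr h)).tail ⟨(j, i), rfl, rfl⟩
    · rw [h]

theorem reachable_of_dirPath {V E : Type} (src tgt : E → V) {u v : V}
    (h : Relation.ReflTransGen (fun a b => ∃ e, src e = a ∧ tgt e = b) u v) :
    (underlyingGraph src tgt).Reachable u v := by
  induction h with
  | refl => exact SimpleGraph.Reachable.refl _
  | tail _ hbc ih =>
    obtain ⟨e, rfl, rfl⟩ := hbc
    exact ih.trans (underlyingGraph_reachable src tgt e)

open Classical in
/-- The diamond graph `D_{k,m}`: `m` directed paths of length `k` with common first vertex (the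
source) and common last vertex (the sink). The edge `(j, i)` is the `j`-th edge of the `i`-th
path. -/
def diamond (k m : ℕ) (hk : 2 ≤ k) (hm : 2 ≤ m) : STGraph :=
  have : NeZero k := ⟨by omega⟩
  have : NeZero m := ⟨by omega⟩
  { V := DiamondV k m
    E := Fin k × Fin m
    fintypeV := inferInstance
    fintypeE := inferInstance
    src := fun e => diamondMk e.1.castSucc e.2
    tgt := fun e => diamondMk e.1.succ e.2
    nonempty_edge := inferInstance
    loopless := by
      rintro ⟨j, i⟩ h
      simp only [diamondMk_eq_iff, Fin.ext_iff, Fin.val_castSucc, Fin.val_succ, Fin.val_zero,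
        Fin.val_last] at h
      omega
    edge_unique := by
      rintro ⟨j, i⟩ ⟨j', i'⟩ h
      simp only [Sym2.eq_iff, diamondMk_eq_iff, Fin.ext_iff, Fin.val_castSucc, Fin.val_succ,
        Fin.val_zero, Fin.val_last, Prod.mk.injEq] at h ⊢
      omega
    connected := by
      have : Nonempty (DiamondV k m) := ⟨diamondMk 0 0⟩
      have hs : ∀ x : DiamondV k m, (underlyingGraph
          (fun e : Fin k × Fin m => (diamondMk e.1.castSucc e.2 : DiamondV k m))
          (fun e => diamondMk e.1.succ e.2)).Reachable (diamondMk 0 0) x := by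
        intro x
        induction x using Quotient.inductionOn with | _ p => ?_
        have h0 : (diamondMk 0 0 : DiamondV k m) = diamondMk 0 p.2 := by simp [diamondMk_eq_iff]
        rw [h0]
        exact reachable_of_dirPath _ _ (diamond_path p.2 (Fin.zero_le p.1))
      exact SimpleGraph.Connected.mk fun x y => (hs x).symm.trans (hs y)
    s := diamondMk 0 0
    t := diamondMk (Fin.last k) 0
    s_ne_t := by
      intro h
      simp only [diamondMk_eq_iff, Fin.ext_iff, Fin.val_zero, Fin.val_last] at h
      omega
    path_from_s := by
      intro x
      induction x using Quotient.inductionOn with | _ p => ?_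
      have h0 : (diamondMk 0 0 : DiamondV k m) = diamondMk 0 p.2 := by simp [diamondMk_eq_iff]
      have h1 := diamond_path p.2 (Fin.zero_le p.1)
      rw [← h0] at h1
      exact h1
    path_to_t := by
      intro x
      induction x using Quotient.inductionOn with | _ p => ?_
      have h0 : (diamondMk (Fin.last k) 0 : DiamondV k m) = diamondMk (Fin.last k) p.2 := by
        simp [diamondMk_eq_iff]
      have h1 := diamond_path p.2 (Fin.le_last p.1)
      rw [← h0] at h1
      exact h1 }

/-! # Measures, metrics, perimeter -/

/-- Probability measures on a finite set with the full power set as σ-algebra, given by the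
masses of the points. -/
abbrev ProbMass (S : Type) [Fintype S] : Type := stdSimplex ℝ S

/-- The measure of a subset. -/
def ProbMass.meas {S : Type} [Fintype S] (μ : ProbMass S) (A : Finset S) : ℝ := ∑ x ∈ A, μ.1 x

namespace DirGraph

/-- The uniform probability measure on the edges. -/
def uniformEdge (G : DirGraph) : ProbMass G.E :=
  ⟨fun _ => 1 / (Fintype.card G.E : ℝ), fun _ => by positivity, by
    have : (Fintype.card G.E : ℝ) ≠ 0 := by exact_mod_cast Fintype.card_ne_zero
    simp [this]⟩

open Classical in
/-- The degree of a vertex: the number of edges that end or start in it. -/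
def deg (G : DirGraph) (x : G.V) : ℕ :=
  (Finset.univ.filter fun e => G.tgt e = x).card + (Finset.univ.filter fun e => G.src e = x).card

theorem sum_deg (G : DirGraph) : ∑ x, G.deg x = 2 * Fintype.card G.E := by
  classical
  have h : ∀ g : G.E → G.V,
      ∑ x, (Finset.univ.filter fun e => g e = x).card = Fintype.card G.E := fun g =>
    (Finset.card_eq_sum_card_fiberwise (f := g) (t := Finset.univ)
      (fun _ _ => Finset.mem_coe.mpr (Finset.mem_univ _))).symm
  have h1 := h G.tgt
  have h2 := h G.src
  simp only [deg, Finset.sum_add_distrib]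
  convert (congrArg₂ (· + ·) h1 h2).trans (two_mul _).symm

/-- The degree-probability measure `x ↦ deg x / (2 |E|)` on the vertices. -/
def degreeProb (G : DirGraph) : ProbMass G.V :=
  ⟨fun x => (G.deg x : ℝ) / (2 * Fintype.card G.E), fun _ => by positivity, by
    have h0 : (Fintype.card G.E : ℝ) ≠ 0 := by exact_mod_cast Fintype.card_ne_zero
    have h : (∑ x, (G.deg x : ℝ)) = 2 * Fintype.card G.E := by exact_mod_cast G.sum_deg
    rw [← Finset.sum_div, h]
    field_simp⟩

/-- The shortest path metric on the vertices in which every edge has length `ℓ`. -/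
abbrev pathMetric (G : DirGraph) (ℓ : ℝ) (hℓ : 0 < ℓ) : MetricSpace G.V where
  dist x y := ℓ * G.toSimple.dist x y
  dist_self x := by simp
  dist_comm x y := by rw [SimpleGraph.dist_comm]
  dist_triangle x y z := by
    have h : G.toSimple.dist x z ≤ G.toSimple.dist x y + G.toSimple.dist y z :=
      G.toSimple_connected.dist_triangle
    have h' : (G.toSimple.dist x z : ℝ) ≤ G.toSimple.dist x y + G.toSimple.dist y z := by
      exact_mod_cast h
    calc ℓ * (G.toSimple.dist x z : ℝ)
        ≤ ℓ * (G.toSimple.dist x y + G.toSimple.dist y z) := by gcongr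
      _ = _ := by ring
  eq_of_dist_eq_zero {x y} h := by
    have h1 : (G.toSimple.dist x y : ℝ) = 0 := (mul_eq_zero.mp h).resolve_left hℓ.ne'
    have h2 : G.toSimple.dist x y = 0 := by exact_mod_cast h1
    exact G.toSimple_connected.dist_eq_zero_iff.mp h2

/-- A metric on the vertices is geodesic if any two vertices `x`, `y` are joined by a path whose
length, the sum of the distances of its consecutive vertices, is the distance of `x` and `y`. -/
def IsGeodesic (G : DirGraph) (d : MetricSpace G.V) : Prop :=
  ∀ x y : G.V, ∃ p : G.toSimple.Walk x y,
    d.dist x y = (p.darts.map fun a => d.dist a.fst a.snd).sum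

theorem pathMetric_isGeodesic (G : DirGraph) (ℓ : ℝ) (hℓ : 0 < ℓ) :
    G.IsGeodesic (G.pathMetric ℓ hℓ) := by
  intro x y
  obtain ⟨p, hp⟩ := G.toSimple_connected.exists_walk_length_eq_dist x y
  refine ⟨p, ?_⟩
  have h1 : (p.darts.map fun a => (G.pathMetric ℓ hℓ).dist a.fst a.snd) =
      p.darts.map fun _ => ℓ := by
    refine List.map_congr_left fun a _ => ?_
    change ℓ * (G.toSimple.dist a.fst a.snd : ℝ) = ℓ
    rw [SimpleGraph.dist_eq_one_iff_adj.mpr a.adj]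
    simp
  rw [h1]
  change ℓ * (G.toSimple.dist x y : ℝ) = _
  have h2 : G.toSimple.dist x y = p.length := hp.symm
  rw [h2]
  simp [mul_comm]

open Classical in
/-- The edge boundary: the edges with exactly one endpoint in `A`. -/
def edgeBoundary (G : DirGraph) (A : Finset G.V) : Finset G.E :=
  Finset.univ.filter fun e => ¬(G.src e ∈ A ↔ G.tgt e ∈ A)

/-- The `(ν, d)`-perimeter of `A`. -/
def perimeter (G : DirGraph) (ν : ProbMass G.E) (d : MetricSpace G.V) (A : Finset G.V) : ℝ :=
  ∑ e ∈ G.edgeBoundary A, ν.1 e / d.dist (G.src e) (G.tgt e)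

open Classical in
/-- `G` has `(μ, ν, d)`-isoperimetric dimension `δ` with constant `C`. -/
structure HasIsoperimetricDimension (G : DirGraph) (μ : ProbMass G.V) (ν : ProbMass G.E)
    (d : MetricSpace G.V) (δ C : ℝ) : Prop where
  one_le_dim : 1 ≤ δ
  const_pos : 0 < C
  geodesic : G.IsGeodesic d
  isoperimetric : ∀ A : Finset G.V,
    (min (μ.meas A) (μ.meas Aᶜ)) ^ ((δ - 1) / δ) ≤ C * G.perimeter ν d A

end DirGraph

/-! # Lipschitz-spectral profile -/

/-- The Lipschitz constant of a function on a finite metric space (the terms with `x = y` are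
`0 / 0 = 0`). -/
def lipConst {X : Type} (d : MetricSpace X) (f : X → ℝ) : ℝ :=
  ⨆ p : X × X, |f p.1 - f p.2| / d.dist p.1 p.2

/-- The Lipschitz growth function of a family of functions. -/
def lipGrowth {X I : Type} (d : MetricSpace X) (F : I → X → ℝ) (s : ℝ) : ℕ∞ :=
  Set.encard {i | lipConst d (F i) ≤ s}

/-- The norm of `L₁(μ)`. -/
def ProbMass.normL1 {S : Type} [Fintype S] (μ : ProbMass S) (f : S → ℝ) : ℝ :=
  ∑ x, μ.1 x * |f x|

/-- The norm of `L_∞(μ)`: the largest value of `|f|` at a point of positive mass. -/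
def ProbMass.normLinf {S : Type} [Fintype S] (μ : ProbMass S) (f : S → ℝ) : ℝ :=
  ⨆ x : {x : S // 0 < μ.1 x}, |f x|

/-- The inner product of `L₂(μ)`. -/
def ProbMass.innerL2 {S : Type} [Fintype S] (μ : ProbMass S) (f g : S → ℝ) : ℝ :=
  ∑ x, μ.1 x * (f x * g x)

/-- `G` has `(μ, d)`-Lipschitz-spectral profile of dimension `δ` and bandwidth `β` with constants
`C₁`, `Cinf`, `Cγ`. -/
structure DirGraph.HasLipschitzSpectralProfile (G : DirGraph) (μ : ProbMass G.V)
    (d : MetricSpace G.V) (δ β C₁ Cinf Cγ : ℝ) : Prop where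
  one_le_dim : 1 ≤ δ
  one_le_bandwidth : 1 ≤ β
  const_one_pos : 0 < C₁
  const_inf_pos : 0 < Cinf
  const_growth_pos : 0 < Cγ
  exists_family : ∃ (I : Type) (F : I → G.V → ℝ),
    (∀ i, C₁⁻¹ ≤ μ.normL1 (F i)) ∧
    (∀ i, μ.normLinf (F i) ≤ Cinf) ∧
    (∀ i j, i ≠ j → μ.innerL2 (F i) (F j) = 0) ∧
    ∀ s : ℝ, 1 ≤ s → s ≤ β → ENNReal.ofReal (Cγ⁻¹ * s ^ δ) ≤ (lipGrowth d F s : ℝ≥0∞)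

/-- The slash power `D_{k,m}^{⊘ n}` of the diamond graph. -/
abbrev diamondPow (k m : ℕ) (hk : 2 ≤ k) (hm : 2 ≤ m) (n : ℕ) : DirGraph :=
  ((diamond k m hk hm).slashPow n).toDirGraph

/-- The shortest path metric on `D_{k,m}^{⊘ n}` in which every edge has length `k⁻ⁿ`. -/
abbrev diamondMetric (k m : ℕ) (hk : 2 ≤ k) (hm : 2 ≤ m) (n : ℕ) :
    MetricSpace (diamondPow k m hk hm n).V :=
  (diamondPow k m hk hm n).pathMetric (((k : ℝ) ^ n)⁻¹)
    (inv_pos.mpr (pow_pos (Nat.cast_pos.mpr (lt_of_lt_of_le Nat.zero_lt_two hk)) n))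

end

noncomputable section

open scoped ENNReal

/-! # Isomorphisms of s-t graphs -/

namespace STGraph

/-! The slash product is associative and has the one-edge graph as a unit, so the power can be
unfolded from the outside: it consists of `k * m` copies of the previous power, placed on the edges
of one diamond (`slashPowIso`). Everything is then an induction over these copies. Integrals against
the degree measure are written as sums over edges of the two endpoint values; such sums split
exactly over the copies, although the copies share vertices.

Isoperimetry. Let `p = (δ - 1) / δ`, so that `(k * m) ^ p = m`. In the given normalization the
perimeter is the number of boundary edges divided by `m ^ n`, and it is at least `1` as soon as the
set separates source from sink (`le_edgeVar_dpow`). For a set that contains neither terminal there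
are two cases (`dpow_isoperimetric`). If some copy has its terminals separated, then the branch
through it changes side at least twice, and the perimeter is at least `2 / m`; this produces the
constant `m / 2`. Otherwise no copy meets the set in a terminal, the induction hypothesis holds in
every copy, and subadditivity of `x ^ p` together with `(k * m) ^ p = m` adds the inequalities up. A
set containing both terminals is replaced by its complement.

Spectral profile. In each of the `(k * m) ^ l` copies of level `l`, take a trapezoid of the height
times a sign that depends on the branch and has sum zero. The height does not see the branch, so
such a wave is orthogonal to all functions of the height (`edgeSum_dwave_mul_dheight`); a coarser
wave, restricted to a copy on a single branch, is a function of the height, whence waves of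
different levels are orthogonal. Within a level, Walsh functions serve as amplitudes on the copies:
they give at least `(k * m) ^ l / 2` orthogonal functions of Lipschitz constant at most `k ^ (l +
1)`. The bound `1 / 6` for the `L₁` norm is `1 / 2` (trapezoid) times `2 / 3` (branch signs) times
`1 / 2` (support of the amplitudes). -/

/-- An isomorphism of s-t graphs. -/
structure Iso (G H : STGraph) where
  v : G.V ≃ H.V
  e : G.E ≃ H.E
  src_eq : ∀ f, H.src (e f) = v (G.src f)
  tgt_eq : ∀ f, H.tgt (e f) = v (G.tgt f)
  s_eq : v G.s = H.s
  t_eq : v G.t = H.t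

namespace Iso

/-- The identity. -/
def refl (G : STGraph) : Iso G G :=
  ⟨Equiv.refl _, Equiv.refl _, fun _ => rfl, fun _ => rfl, rfl, rfl⟩

/-- The inverse isomorphism. -/
def symm {G H : STGraph} (φ : Iso G H) : Iso H G where
  v := φ.v.symm
  e := φ.e.symm
  src_eq f := by rw [Equiv.eq_symm_apply, ← φ.src_eq, Equiv.apply_symm_apply]
  tgt_eq f := by rw [Equiv.eq_symm_apply, ← φ.tgt_eq, Equiv.apply_symm_apply]
  s_eq := by rw [Equiv.symm_apply_eq, φ.s_eq]
  t_eq := by rw [Equiv.symm_apply_eq, φ.t_eq]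

/-- The composition of isomorphisms. -/
def trans {G H K : STGraph} (φ : Iso G H) (ψ : Iso H K) : Iso G K where
  v := φ.v.trans ψ.v
  e := φ.e.trans ψ.e
  src_eq f := by simp [ψ.src_eq, φ.src_eq]
  tgt_eq f := by simp [ψ.tgt_eq, φ.tgt_eq]
  s_eq := by simp [ψ.s_eq, φ.s_eq]
  t_eq := by simp [ψ.t_eq, φ.t_eq]

/-- The slash product is functorial. -/
def slash {G G' H H' : STGraph} (φ : Iso H H') (ψ : Iso G G') :
    Iso (H.slash G) (H'.slash G') where
  v := Quotient.congr (Equiv.prodCongr φ.e ψ.v) fun p q => by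
    change _ = _ ∨ _ ↔ _ = _ ∨ _
    simp [φ.src_eq, φ.tgt_eq, ← ψ.s_eq, ← ψ.t_eq, Prod.ext_iff]
  e := Equiv.prodCongr φ.e ψ.e
  src_eq f := by
    change slashMk (φ.e f.1) (G'.src (ψ.e f.2)) = slashMk (φ.e f.1) (ψ.v (G.src f.2))
    rw [ψ.src_eq]
  tgt_eq f := by
    change slashMk (φ.e f.1) (G'.tgt (ψ.e f.2)) = slashMk (φ.e f.1) (ψ.v (G.tgt f.2))
    rw [ψ.tgt_eq]
  s_eq := by
    obtain ⟨e, he⟩ := H.exists_src_eq_s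
    have he' : H'.src (φ.e e) = H'.s := by rw [φ.src_eq, he, φ.s_eq]
    change Quotient.congr _ _ (H.slashS G) = H'.slashS G'
    rw [H.slashS_eq G he, H'.slashS_eq G' he']
    exact congrArg (slashMk (H := H'.toDirGraph) (φ.e e)) ψ.s_eq
  t_eq := by
    obtain ⟨e, he⟩ := H.exists_tgt_eq_t
    have he' : H'.tgt (φ.e e) = H'.t := by rw [φ.tgt_eq, he, φ.t_eq]
    change Quotient.congr _ _ (H.slashT G) = H'.slashT G'
    rw [H.slashT_eq G he, H'.slashT_eq G' he']
    exact congrArg (slashMk (H := H'.toDirGraph) (φ.e e)) ψ.t_eq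

end Iso

/-! ### Associativity and units of the slash product -/

theorem slash_src_eq_s {H G : STGraph} {e : H.E} {f : G.E} (he : H.src e = H.s)
    (hf : G.src f = G.s) : (H.slash G).src (e, f) = (H.slash G).s := by
  change slashMk e (G.src f) = H.slashS G
  rw [H.slashS_eq G he, hf]

theorem slash_tgt_eq_t {H G : STGraph} {e : H.E} {f : G.E} (he : H.tgt e = H.t)
    (hf : G.tgt f = G.t) : (H.slash G).tgt (e, f) = (H.slash G).t := by
  change slashMk e (G.tgt f) = H.slashT G
  rw [H.slashT_eq G he, hf]

theorem slash_s_eq {H G : STGraph} {e : H.E} (he : H.src e = H.s) :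
    (H.slash G).s = (slashMk e G.s : SlashV H.toDirGraph G) := H.slashS_eq G he

theorem slash_t_eq {H G : STGraph} {e : H.E} (he : H.tgt e = H.t) :
    (H.slash G).t = (slashMk e G.t : SlashV H.toDirGraph G) := H.slashT_eq G he

/-- The two directions are the well-definedness and the injectivity of the associator. The gluing
relation of `H ⊘ (G ⊘ K)` refers to the terminals of `G ⊘ K`, so these are first described by
incidences in `G` and terminals of `K`. -/
theorem assoc_iff (H G K : STGraph) (e e' : H.E) (f f' : G.E) (u u' : K.V) :
    (slashMk (H := (H.slash G).toDirGraph) (G := K) (e, f) u = slashMk (e', f') u') ↔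
    (slashMk (H := H.toDirGraph) (G := G.slash K) e
      (slashMk (H := G.toDirGraph) (G := K) f u) = slashMk e' (slashMk f' u')) := by
  obtain ⟨a, ha⟩ := G.exists_src_eq_s
  obtain ⟨b, hb⟩ := G.exists_tgt_eq_t
  have hs : ∀ (f : G.E) u, slashMk (H := G.toDirGraph) (G := K) f u = (G.slash K).s ↔
      (G.src f = G.s ∧ u = K.s) ∨ (G.tgt f = G.s ∧ u = K.t) := by
    intro f u
    rw [slash_s_eq ha, slashMk_eq_iff]
    have := K.s_ne_t
    grind
  have ht : ∀ (f : G.E) u, slashMk (H := G.toDirGraph) (G := K) f u = (G.slash K).t ↔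
      (G.src f = G.t ∧ u = K.s) ∨ (G.tgt f = G.t ∧ u = K.t) := by
    intro f u
    rw [slash_t_eq hb, slashMk_eq_iff]
    have := K.s_ne_t
    grind
  have h1 := slashMk_eq_iff (H := (H.slash G).toDirGraph) (G := K) (e := (e, f)) (f := (e', f'))
    (u := u) (v := u')
  have h2 := slashMk_eq_iff (H := H.toDirGraph) (G := G.slash K) (e := e) (f := e')
    (u := slashMk (H := G.toDirGraph) f u) (v := slashMk (H := G.toDirGraph) f' u')
  have h3 := slashMk_eq_iff (H := G.toDirGraph) (G := K) (e := f) (f := f') (u := u) (v := u')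
  have h4 (a b : G.V) : slashMk (H := H.toDirGraph) (G := G) e a = slashMk e' b ↔ _ :=
    slashMk_eq_iff
  have h5 : ((e, f) : H.E × G.E) = (e', f') ↔ _ := Prod.mk_inj
  refine h1.trans (Iff.trans ?_ h2.symm)
  refine (or_congr (and_congr_left' h5) (or_congr (and_congr_left' (h4 _ _)) (or_congr
    (and_congr_left' (h4 _ _)) (or_congr (and_congr_left' (h4 _ _))
    (and_congr_left' (h4 _ _)))))).trans (Iff.trans ?_ (or_congr (and_congr_right' h3)
    (or_congr (and_congr_right' (and_congr (ht f u) (hs f' u')))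
    (or_congr (and_congr_right' (and_congr (hs f u) (ht f' u')))
    (or_congr (and_congr_right' (and_congr (ht f u) (ht f' u')))
    (and_congr_right' (and_congr (hs f u) (hs f' u'))))))).symm)
  have h6 := K.s_ne_t
  have h7 := K.s_ne_t.symm
  clear h1 h2 h3 h4 h5 hs ht
  -- Once it is decided which of `u`, `u'` are terminals of `K`, only incidences of edges in `H` and
  -- `G` are left.
  by_cases hus : u = K.s <;> by_cases hut : u = K.t <;> by_cases hus' : u' = K.s <;>
    by_cases hut' : u' = K.t <;> simp_all <;> grind

/-- The slash product is associative. -/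
def slashAssoc (H G K : STGraph) : Iso ((H.slash G).slash K) (H.slash (G.slash K)) where
  v := Equiv.ofBijective
    (Quotient.lift (fun p : (H.E × G.E) × K.V =>
      slashMk (H := H.toDirGraph) (G := G.slash K) p.1.1
        (slashMk (H := G.toDirGraph) (G := K) p.1.2 p.2))
      fun p q h => (assoc_iff H G K p.1.1 q.1.1 p.1.2 q.1.2 p.2 q.2).mp (Quotient.sound h)) (by
      constructor
      · intro x y h
        induction x using Quotient.inductionOn with | _ p => ?_
        induction y using Quotient.inductionOn with | _ q => ?_
        exact (assoc_iff H G K p.1.1 q.1.1 p.1.2 q.1.2 p.2 q.2).mpr h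
      · intro x
        induction x using Quotient.inductionOn with | _ p => ?_
        obtain ⟨e, y⟩ := p
        induction y using Quotient.inductionOn with | _ q => ?_
        exact ⟨slashMk (H := (H.slash G).toDirGraph) (G := K) (e, q.1) q.2, rfl⟩)
  e := Equiv.prodAssoc _ _ _
  src_eq f := rfl
  tgt_eq f := rfl
  s_eq := by
    obtain ⟨e, he⟩ := H.exists_src_eq_s
    obtain ⟨f, hf⟩ := G.exists_src_eq_s
    rw [slash_s_eq (slash_src_eq_s he hf), slash_s_eq he, slash_s_eq hf]
    rfl
  t_eq := by
    obtain ⟨e, he⟩ := H.exists_tgt_eq_t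
    obtain ⟨f, hf⟩ := G.exists_tgt_eq_t
    rw [slash_t_eq (slash_tgt_eq_t he hf), slash_t_eq he, slash_t_eq hf]
    rfl

/-- The graph with one edge. -/
def edge : STGraph where
  V := Bool
  E := Unit
  fintypeV := inferInstance
  fintypeE := inferInstance
  src _ := false
  tgt _ := true
  nonempty_edge := inferInstance
  loopless _ := by simp
  edge_unique _ _ _ := rfl
  connected := by
    have h := underlyingGraph_reachable (fun _ : Unit => false) (fun _ => true) ()
    refine SimpleGraph.Connected.mk ?_
    rintro (_ | _) (_ | _)
    · exact SimpleGraph.Reachable.refl _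
    · exact h
    · exact h.symm
    · exact SimpleGraph.Reachable.refl _
  s := false
  t := true
  s_ne_t := by simp
  path_from_s := by
    rintro (_ | _)
    · exact Relation.ReflTransGen.refl
    · exact Relation.ReflTransGen.single ⟨(), rfl, rfl⟩
  path_to_t := by
    rintro (_ | _)
    · exact Relation.ReflTransGen.single ⟨(), rfl, rfl⟩
    · exact Relation.ReflTransGen.refl

/-- The graph with one edge is a left unit of the slash product. -/
def edgeSlash (G : STGraph) : Iso (edge.slash G) G :=
  Iso.symm
  { v := Equiv.ofBijective (fun u => slashMk (H := edge.toDirGraph) (G := G) () u) (by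
      constructor
      · intro u v h
        exact slashMk_inj h
      · intro x
        induction x using Quotient.inductionOn with | _ p => ?_
        exact ⟨p.2, rfl⟩)
    e := (Equiv.punitProd _).symm
    src_eq := fun _ => rfl
    tgt_eq := fun _ => rfl
    s_eq := (slash_s_eq (H := edge) (e := ()) rfl).symm
    t_eq := (slash_t_eq (H := edge) (e := ()) rfl).symm }

theorem exists_edge (G : STGraph) (x : G.V) : ∃ e, G.src e = x ∨ G.tgt e = x := by
  rcases Relation.ReflTransGen.cases_head (G.path_to_t x) with h | ⟨_, ⟨e, he, -⟩, -⟩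
  · obtain ⟨e, he⟩ := G.exists_tgt_eq_t
    exact ⟨e, Or.inr (he.trans h.symm)⟩
  · exact ⟨e, Or.inl he⟩

/-- The graph with one edge is a right unit of the slash product. -/
def slashEdge (G : STGraph) : Iso (G.slash edge) G where
  v := Equiv.ofBijective (Quotient.lift
      (fun p : G.E × Bool => if p.2 then G.tgt p.1 else G.src p.1) (by
        rintro ⟨e, b⟩ ⟨f, c⟩ h
        have h' := slashMk_eq_iff.mp (Quotient.sound h : slashMk e b = slashMk f c)
        simp only [edge] at h'
        grind)) (by
      constructor
      · intro x y h
        induction x using Quotient.inductionOn with | _ p => ?_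
        induction y using Quotient.inductionOn with | _ q => ?_
        refine slashMk_eq_iff.mpr ?_
        obtain ⟨e, b⟩ := p
        obtain ⟨f, c⟩ := q
        change Bool at b c
        change (if b then G.tgt e else G.src e) = (if c then G.tgt f else G.src f) at h
        change _ ∨ (_ ∧ b = true ∧ c = false) ∨ (_ ∧ b = false ∧ c = true) ∨
          (_ ∧ b = true ∧ c = true) ∨ (_ ∧ b = false ∧ c = false)
        cases b <;> cases c <;> simp_all
      · intro x
        obtain ⟨e, he | he⟩ := G.exists_edge x
        · exact ⟨slashMk (G := edge) e false, he⟩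
        · exact ⟨slashMk (G := edge) e true, he⟩)
  e := Equiv.prodPUnit _
  src_eq f := rfl
  tgt_eq f := rfl
  s_eq := by
    obtain ⟨e, he⟩ := G.exists_src_eq_s
    rw [slash_s_eq he]
    exact he
  t_eq := by
    obtain ⟨e, he⟩ := G.exists_tgt_eq_t
    rw [slash_t_eq he]
    exact he

/-! ### Slash powers unfolded from the outside -/

/-- The slash power with the factors multiplied from the left, starting with one edge. -/
def leftPow (D : STGraph) : ℕ → STGraph
  | 0 => edge
  | n + 1 => D.slash (D.leftPow n)

/-- Multiplication of a left slash power from the right. -/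
def leftPowSlash (D : STGraph) : ∀ n, Iso ((D.leftPow n).slash D) (D.leftPow (n + 1))
  | 0 => (edgeSlash D).trans (slashEdge D).symm
  | n + 1 => (slashAssoc D (D.leftPow n) D).trans ((Iso.refl D).slash (leftPowSlash D n))

/-- Slash powers can be computed from the left. -/
def slashPowIso (D : STGraph) : ∀ n, Iso (D.slashPow (n + 1)) (D.leftPow (n + 1))
  | 0 => (slashEdge D).symm
  | n + 1 => ((slashPowIso D n).slash (Iso.refl D)).trans (leftPowSlash D (n + 1))

end STGraph

/-! # Sums over edges -/

namespace DirGraph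

/-- The sum of a function over the endpoints of all edges. -/
def edgeSum (G : DirGraph) (φ : G.V → ℝ) : ℝ := ∑ e, (φ (G.src e) + φ (G.tgt e))

/-- The total variation of a function along the edges. -/
def edgeVar (G : DirGraph) (φ : G.V → ℝ) : ℝ := ∑ e, |φ (G.tgt e) - φ (G.src e)|

variable (G : DirGraph)

theorem edgeSum_mono {φ ψ : G.V → ℝ} (h : ∀ x, φ x ≤ ψ x) : G.edgeSum φ ≤ G.edgeSum ψ :=
  Finset.sum_le_sum fun _ _ => add_le_add (h _) (h _)

theorem edgeSum_nonneg {φ : G.V → ℝ} (h : ∀ x, 0 ≤ φ x) : 0 ≤ G.edgeSum φ :=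
  Finset.sum_nonneg fun _ _ => add_nonneg (h _) (h _)

theorem edgeVar_nonneg (φ : G.V → ℝ) : 0 ≤ G.edgeVar φ :=
  Finset.sum_nonneg fun _ _ => abs_nonneg _

theorem edgeSum_const (c : ℝ) : G.edgeSum (fun _ => c) = 2 * Fintype.card G.E * c := by
  simp [edgeSum]
  ring

theorem edgeSum_mul_left (c : ℝ) (φ : G.V → ℝ) :
    G.edgeSum (fun x => c * φ x) = c * G.edgeSum φ := by
  simp only [edgeSum, Finset.mul_sum, mul_add]

theorem edgeSum_sum {ι : Type} (s : Finset ι) (φ : ι → G.V → ℝ) :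
    G.edgeSum (fun x => ∑ i ∈ s, φ i x) = ∑ i ∈ s, G.edgeSum (φ i) := by
  simp only [edgeSum, ← Finset.sum_add_distrib]
  exact Finset.sum_comm

/-- Double counting: a vertex occurs as an endpoint of an edge as often as its degree says. This
turns every integral against the degree measure into an edge sum. -/
theorem sum_degreeProb_mul (φ : G.V → ℝ) :
    ∑ x, G.degreeProb.1 x * φ x = G.edgeSum φ / (2 * Fintype.card G.E) := by
  classical
  have h : ∀ g : G.E → G.V,
      ∑ x, ((Finset.univ.filter fun e => g e = x).card : ℝ) * φ x = ∑ e, φ (g e) := by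
    intro g
    rw [← Finset.sum_fiberwise (s := Finset.univ) (g := g)]
    refine Finset.sum_congr rfl fun x _ => ?_
    rw [Finset.sum_congr rfl (g := fun _ => φ x) fun e he => by rw [(Finset.mem_filter.mp he).2]]
    simp
  have h1 : ∀ x, G.degreeProb.1 x * φ x = (((Finset.univ.filter fun e => G.src e = x).card : ℝ) *
      φ x + ((Finset.univ.filter fun e => G.tgt e = x).card : ℝ) * φ x) /
      (2 * Fintype.card G.E) := by
    intro x
    have : (G.deg x : ℝ) = (Finset.univ.filter fun e => G.src e = x).card +
        (Finset.univ.filter fun e => G.tgt e = x).card := by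
      simp only [deg]
      push_cast
      rw [add_comm]
    change (G.deg x : ℝ) / (2 * Fintype.card G.E) * φ x = _
    rw [this]
    ring
  rw [Finset.sum_congr rfl fun x _ => h1 x, ← Finset.sum_div, Finset.sum_add_distrib, h, h,
    edgeSum, Finset.sum_add_distrib]

end DirGraph

theorem STGraph.Iso.edgeSum_comp {G H : STGraph} (φ : STGraph.Iso G H) (f : H.V → ℝ) :
    G.edgeSum (fun x => f (φ.v x)) = H.edgeSum f := by
  refine Fintype.sum_equiv φ.e _ _ fun e => ?_
  rw [φ.src_eq, φ.tgt_eq]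

theorem STGraph.Iso.edgeVar_comp {G H : STGraph} (φ : STGraph.Iso G H) (f : H.V → ℝ) :
    G.edgeVar (fun x => f (φ.v x)) = H.edgeVar f := by
  refine Fintype.sum_equiv φ.e _ _ fun e => ?_
  rw [φ.src_eq, φ.tgt_eq]

/-! # Left slash powers of the diamond graph -/

/-- The left slash power of the diamond graph. -/
abbrev dpow (k m : ℕ) (hk : 2 ≤ k) (hm : 2 ≤ m) (n : ℕ) : STGraph :=
  (diamond k m hk hm).leftPow n

section dpow

variable {k m : ℕ} {hk : 2 ≤ k} {hm : 2 ≤ m} {n : ℕ}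

/-- The vertex `u` in the copy indexed by the `j`-th edge of the `i`-th path. -/
def dmk (j : Fin k) (i : Fin m) (u : (dpow k m hk hm n).V) : (dpow k m hk hm (n + 1)).V :=
  slashMk (H := (diamond k m hk hm).toDirGraph) (G := dpow k m hk hm n) (j, i) u

theorem dmk_surj (x : (dpow k m hk hm (n + 1)).V) : ∃ j i u, dmk j i u = x := by
  induction x using Quotient.inductionOn with | _ p => ?_
  exact ⟨p.1.1, p.1.2, p.2, rfl⟩

/-- Two copies meet only if they are consecutive on a branch, both start at the source, or both end
at the sink. An inner vertex of a branch determines the branch, hence `i = i'` in the second and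
third case. -/
theorem dmk_eq {j j' : Fin k} {i i' : Fin m} {u u' : (dpow k m hk hm n).V}
    (h : dmk j i u = dmk j' i' u') : (j = j' ∧ i = i' ∧ u = u') ∨
      ((j : ℕ) + 1 = j' ∧ i = i' ∧ u = (dpow k m hk hm n).t ∧ u' = (dpow k m hk hm n).s) ∨
      ((j' : ℕ) + 1 = j ∧ i = i' ∧ u = (dpow k m hk hm n).s ∧ u' = (dpow k m hk hm n).t) ∨
      ((j : ℕ) + 1 = k ∧ (j' : ℕ) + 1 = k ∧ u = (dpow k m hk hm n).t ∧
        u' = (dpow k m hk hm n).t) ∨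
      ((j : ℕ) = 0 ∧ (j' : ℕ) = 0 ∧ u = (dpow k m hk hm n).s ∧ u' = (dpow k m hk hm n).s) := by
  have h1 := slashMk_eq_iff.mp h
  have hs : ∀ e : Fin k × Fin m, (diamond k m hk hm).src e = diamondMk e.1.castSucc e.2 :=
    fun _ => rfl
  have ht : ∀ e : Fin k × Fin m, (diamond k m hk hm).tgt e = diamondMk e.1.succ e.2 :=
    fun _ => rfl
  have h2 : (((j, i) : Fin k × Fin m) = (j', i') ∧ u = u') ∨
      ((diamondMk j.succ i : DiamondV k m) = diamondMk j'.castSucc i' ∧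
        u = (dpow k m hk hm n).t ∧ u' = (dpow k m hk hm n).s) ∨
      ((diamondMk j.castSucc i : DiamondV k m) = diamondMk j'.succ i' ∧
        u = (dpow k m hk hm n).s ∧ u' = (dpow k m hk hm n).t) ∨
      ((diamondMk j.succ i : DiamondV k m) = diamondMk j'.succ i' ∧
        u = (dpow k m hk hm n).t ∧ u' = (dpow k m hk hm n).t) ∨
      ((diamondMk j.castSucc i : DiamondV k m) = diamondMk j'.castSucc i' ∧
        u = (dpow k m hk hm n).s ∧ u' = (dpow k m hk hm n).s) := h1
  simp only [diamondMk_eq_iff, Fin.ext_iff, Fin.val_castSucc, Fin.val_succ, Fin.val_zero,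
    Fin.val_last, Prod.mk.injEq] at h2 ⊢
  grind

theorem dmk_glue {j j' : Fin k} (h : (j : ℕ) + 1 = j') (i : Fin m) :
    (dmk j i (dpow k m hk hm n).t : (dpow k m hk hm (n + 1)).V) =
      dmk j' i (dpow k m hk hm n).s := by
  refine slashMk_eq_iff.mpr (Or.inr (Or.inl ⟨?_, rfl, rfl⟩))
  refine diamondMk_eq_iff.mpr (Or.inl ⟨?_, rfl⟩)
  ext
  simpa using h

theorem dmk_source {j : Fin k} (h : (j : ℕ) = 0) (i : Fin m) :
    (dmk j i (dpow k m hk hm n).s : (dpow k m hk hm (n + 1)).V) = (dpow k m hk hm (n + 1)).s := by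
  refine (STGraph.slash_s_eq (H := diamond k m hk hm) (G := dpow k m hk hm n)
    (e := (j, i)) ?_).symm
  refine diamondMk_eq_iff.mpr (Or.inr (Or.inl ⟨?_, rfl⟩))
  ext
  simpa using h

theorem dmk_sink {j : Fin k} (h : (j : ℕ) + 1 = k) (i : Fin m) :
    (dmk j i (dpow k m hk hm n).t : (dpow k m hk hm (n + 1)).V) = (dpow k m hk hm (n + 1)).t := by
  refine (STGraph.slash_t_eq (H := diamond k m hk hm) (G := dpow k m hk hm n)
    (e := (j, i)) ?_).symm
  refine diamondMk_eq_iff.mpr (Or.inr (Or.inr ⟨?_, rfl⟩))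
  ext
  simpa using h

theorem edgeSum_dpow_succ (φ : (dpow k m hk hm (n + 1)).V → ℝ) :
    (dpow k m hk hm (n + 1)).edgeSum φ =
      ∑ j, ∑ i, (dpow k m hk hm n).edgeSum fun u => φ (dmk j i u) := by
  refine (Fintype.sum_prod_type _).trans ?_
  exact Fintype.sum_prod_type _

theorem edgeVar_dpow_succ (φ : (dpow k m hk hm (n + 1)).V → ℝ) :
    (dpow k m hk hm (n + 1)).edgeVar φ =
      ∑ j, ∑ i, (dpow k m hk hm n).edgeVar fun u => φ (dmk j i u) := by
  refine (Fintype.sum_prod_type _).trans ?_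
  exact Fintype.sum_prod_type _

theorem edgeSum_dpow_zero (φ : (dpow k m hk hm 0).V → ℝ) :
    (dpow k m hk hm 0).edgeSum φ = φ (dpow k m hk hm 0).s + φ (dpow k m hk hm 0).t :=
  Fintype.sum_unique (ι := Unit) _

theorem edgeVar_dpow_zero (φ : (dpow k m hk hm 0).V → ℝ) :
    (dpow k m hk hm 0).edgeVar φ = |φ (dpow k m hk hm 0).t - φ (dpow k m hk hm 0).s| :=
  Fintype.sum_unique (ι := Unit) _

theorem card_dpow_edge : ∀ n, Fintype.card (dpow k m hk hm n).E = (k * m) ^ n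
  | 0 => rfl
  | n + 1 => by
    have h : Fintype.card (dpow k m hk hm (n + 1)).E =
        Fintype.card (Fin k × Fin m) * Fintype.card (dpow k m hk hm n).E := Fintype.card_prod _ _
    rw [h, card_dpow_edge n, Fintype.card_prod, Fintype.card_fin, Fintype.card_fin, pow_succ']

/-- The sum of the increments along a path of the outermost diamond. -/
theorem sum_increments (χ : (dpow k m hk hm (n + 1)).V → ℝ) (i : Fin m) :
    ∑ j, (χ (dmk j i (dpow k m hk hm n).t) - χ (dmk j i (dpow k m hk hm n).s)) =
      χ (dpow k m hk hm (n + 1)).t - χ (dpow k m hk hm (n + 1)).s := by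
  -- The values at the successive gluing points of the branch, continued by the value at the sink;
  -- the sum then telescopes.
  let a : ℕ → ℝ := fun j => if h : j < k then χ (dmk ⟨j, h⟩ i (dpow k m hk hm n).s)
    else χ (dpow k m hk hm (n + 1)).t
  have h1 : ∀ j : Fin k, χ (dmk j i (dpow k m hk hm n).s) = a j := by
    intro j
    simp [a]
  have h2 : ∀ j : Fin k, χ (dmk j i (dpow k m hk hm n).t) = a (j + 1) := by
    intro j
    by_cases h : (j : ℕ) + 1 < k
    · simp only [a, h, dif_pos]
      rw [dmk_glue (j' := ⟨j + 1, h⟩) rfl]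
    · simp only [a, h, dif_neg, not_false_eq_true]
      rw [dmk_sink (by omega)]
  have h0 : a 0 = χ (dpow k m hk hm (n + 1)).s := by
    have : 0 < k := by omega
    simp only [a, this, dif_pos]
    rw [dmk_source rfl]
  have hk' : a k = χ (dpow k m hk hm (n + 1)).t := by simp [a]
  simp only [h1, h2]
  rw [Fin.sum_univ_eq_sum_range (fun j => a (j + 1) - a j), Finset.sum_range_sub, h0, hk']

/-! # Isoperimetry -/

/-- A function on the left slash power varies by at least `mⁿ` times its increment from the source
to the sink. -/
theorem le_edgeVar_dpow : ∀ (n : ℕ) (χ : (dpow k m hk hm n).V → ℝ),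
    (m : ℝ) ^ n * |χ (dpow k m hk hm n).t - χ (dpow k m hk hm n).s| ≤
      (dpow k m hk hm n).edgeVar χ
  | 0, χ => by
    rw [edgeVar_dpow_zero]
    simp
  | n + 1, χ => by
    rw [edgeVar_dpow_succ, Finset.sum_comm]
    have h : ∀ i ∈ (Finset.univ : Finset (Fin m)),
        (m : ℝ) ^ n * |χ (dpow k m hk hm (n + 1)).t - χ (dpow k m hk hm (n + 1)).s| ≤
        ∑ j, (dpow k m hk hm n).edgeVar fun u => χ (dmk j i u) := by
      intro i _
      -- Every branch carries the full increment from source to sink, distributed over its copies;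
      -- the `m` branches supply the additional factor `m`.
      rw [← sum_increments χ i]
      calc _ ≤ (m : ℝ) ^ n * ∑ j, |χ (dmk j i (dpow k m hk hm n).t) -
              χ (dmk j i (dpow k m hk hm n).s)| := by
            gcongr
            exact Finset.abs_sum_le_sum_abs _ _
        _ ≤ _ := by
            rw [Finset.mul_sum]
            exact Finset.sum_le_sum fun j _ => le_edgeVar_dpow n fun u => χ (dmk j i u)
    refine le_trans (le_of_eq ?_) (Finset.card_nsmul_le_sum _ _ _ h)
    simp [pow_succ']
    ring

theorem rpow_sum_le_sum_rpow {ι : Type} (s : Finset ι) (x : ι → ℝ) (hx : ∀ i, 0 ≤ x i) {p : ℝ}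
    (hp0 : 0 < p) (hp1 : p ≤ 1) : (∑ i ∈ s, x i) ^ p ≤ ∑ i ∈ s, x i ^ p := by
  classical
  induction s using Finset.induction_on with
  | empty => simp [Real.zero_rpow hp0.ne']
  | insert a s ha ih =>
    rw [Finset.sum_insert ha, Finset.sum_insert ha]
    exact (Real.rpow_add_le_add_rpow (hx a) (Finset.sum_nonneg fun i _ => hx i) hp0.le hp1).trans
      (by gcongr)

theorem edgeSum_dpow_div_le_one {φ : (dpow k m hk hm n).V → ℝ} (h : ∀ x, φ x ≤ 1) :
    (dpow k m hk hm n).edgeSum φ / (2 * ((k : ℝ) * m) ^ n) ≤ 1 := by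
  have hkm : 0 < (k : ℝ) * m := by
    have : 0 < k := by omega
    have : 0 < m := by omega
    positivity
  rw [div_le_one (by positivity)]
  refine ((dpow k m hk hm n).edgeSum_mono h).trans (le_of_eq ?_)
  rw [DirGraph.edgeSum_const, card_dpow_edge]
  push_cast
  ring

/-- The isoperimetric inequality for sets that contain neither the source nor the sink. -/
theorem dpow_isoperimetric {p : ℝ} (hp0 : 0 < p) (hp1 : p ≤ 1) (hp : ((k : ℝ) * m) ^ p = m) :
    ∀ (n : ℕ) (χ : (dpow k m hk hm n).V → ℝ), (∀ x, χ x = 0 ∨ χ x = 1) →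
      χ (dpow k m hk hm n).s = 0 → χ (dpow k m hk hm n).t = 0 →
      ((dpow k m hk hm n).edgeSum χ / (2 * ((k : ℝ) * m) ^ n)) ^ p ≤
        (m : ℝ) / 2 * ((dpow k m hk hm n).edgeVar χ / (m : ℝ) ^ n)
  | 0, χ, _, hs, ht => by
    rw [edgeSum_dpow_zero, edgeVar_dpow_zero, hs, ht]
    simp [Real.zero_rpow hp0.ne']
  | n + 1, χ, h01, hs, ht => by
    have hm0 : (0 : ℝ) < m := by
      have : 0 < m := by omega
      positivity
    have hk0 : (0 : ℝ) < k := by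
      have : 0 < k := by omega
      positivity
    have hχ0 : ∀ x, 0 ≤ χ x := fun x => by rcases h01 x with h | h <;> simp [h]
    have hχ1 : ∀ x, χ x ≤ 1 := fun x => by rcases h01 x with h | h <;> simp [h]
    -- Either some copy has its terminals separated, and the perimeter is large, or the inequality
    -- is inherited from the copies.
    by_cases hsep : ∃ j i, χ (dmk j i (dpow k m hk hm n).t) ≠ χ (dmk j i (dpow k m hk hm n).s)
    · obtain ⟨j, i, hji⟩ := hsep
      have h1 : |χ (dmk j i (dpow k m hk hm n).t) - χ (dmk j i (dpow k m hk hm n).s)| = 1 := by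
        rcases h01 (dmk j i (dpow k m hk hm n).t) with h | h <;>
          rcases h01 (dmk j i (dpow k m hk hm n).s) with h' | h' <;> simp_all
      -- The branch starts and ends with the value `0`, so its increments sum to zero and the jump
      -- of size `1` is compensated by the other copies.
      have h2 : 2 ≤ ∑ j, |χ (dmk j i (dpow k m hk hm n).t) -
          χ (dmk j i (dpow k m hk hm n).s)| := by
        have h3 := sum_increments χ i
        rw [hs, ht, ← Finset.add_sum_erase _ _ (Finset.mem_univ j)] at h3
        rw [← Finset.add_sum_erase _ _ (Finset.mem_univ j), h1]
        have h4 := Finset.abs_sum_le_sum_abs (fun j => χ (dmk j i (dpow k m hk hm n).t) -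
          χ (dmk j i (dpow k m hk hm n).s)) (Finset.univ.erase j)
        have h5 : ∑ j ∈ Finset.univ.erase j, (χ (dmk j i (dpow k m hk hm n).t) -
          χ (dmk j i (dpow k m hk hm n).s)) =
          -(χ (dmk j i (dpow k m hk hm n).t) - χ (dmk j i (dpow k m hk hm n).s)) := by
          linarith
        rw [h5, abs_neg, h1] at h4
        linarith
      have h3 : (m : ℝ) ^ n * 2 ≤ (dpow k m hk hm (n + 1)).edgeVar χ := by
        rw [edgeVar_dpow_succ, Finset.sum_comm]
        calc (m : ℝ) ^ n * 2 ≤ (m : ℝ) ^ n * ∑ j, |χ (dmk j i (dpow k m hk hm n).t) -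
              χ (dmk j i (dpow k m hk hm n).s)| := by gcongr
          _ ≤ ∑ j, (dpow k m hk hm n).edgeVar fun u => χ (dmk j i u) := by
            rw [Finset.mul_sum]
            exact Finset.sum_le_sum fun j _ => le_edgeVar_dpow n fun u => χ (dmk j i u)
          _ ≤ _ := Finset.single_le_sum (f := fun i => ∑ j, (dpow k m hk hm n).edgeVar
              fun u => χ (dmk j i u)) (fun i _ => Finset.sum_nonneg fun j _ =>
              DirGraph.edgeVar_nonneg _ _) (Finset.mem_univ i)
      calc _ ≤ (1 : ℝ) := Real.rpow_le_one (div_nonneg (DirGraph.edgeSum_nonneg _ hχ0)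
            (by positivity)) (edgeSum_dpow_div_le_one hχ1) hp0.le
        _ = (m : ℝ) / 2 * ((m : ℝ) ^ n * 2 / (m : ℝ) ^ (n + 1)) := by
            field_simp
            ring
        _ ≤ _ := by gcongr
    · push Not at hsep
      -- Without separated copies, the value `0` at the source propagates along each branch, so the
      -- induction hypothesis applies to every copy.
      have hzero : ∀ i (a : ℕ) (ha : a < k), χ (dmk ⟨a, ha⟩ i (dpow k m hk hm n).s) = 0 := by
        intro i a
        induction a with
        | zero =>
          intro ha
          rw [dmk_source rfl, hs]
        | succ a ih =>
          intro ha
          rw [← dmk_glue (j := ⟨a, by omega⟩) rfl, hsep, ih]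
      have hIH : ∀ j i, ((dpow k m hk hm n).edgeSum (fun u => χ (dmk j i u)) /
          (2 * ((k : ℝ) * m) ^ n)) ^ p ≤ (m : ℝ) / 2 *
          ((dpow k m hk hm n).edgeVar (fun u => χ (dmk j i u)) / (m : ℝ) ^ n) := fun j i =>
        dpow_isoperimetric hp0 hp1 hp n (fun u => χ (dmk j i u)) (fun u => h01 _)
          (hzero i j j.2) ((hsep j i).trans (hzero i j j.2))
      have hsplit : (dpow k m hk hm (n + 1)).edgeSum χ / (2 * ((k : ℝ) * m) ^ (n + 1)) =
          (∑ q : Fin k × Fin m, (dpow k m hk hm n).edgeSum (fun u => χ (dmk q.1 q.2 u)) /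
          (2 * ((k : ℝ) * m) ^ n)) / (k * m) := by
        rw [edgeSum_dpow_succ, ← Finset.sum_div, Fintype.sum_prod_type, pow_succ]
        field_simp
      have hnn : ∀ q : Fin k × Fin m, 0 ≤ (dpow k m hk hm n).edgeSum
          (fun u => χ (dmk q.1 q.2 u)) / (2 * ((k : ℝ) * m) ^ n) := fun q =>
        div_nonneg (DirGraph.edgeSum_nonneg _ fun u => hχ0 _) (by positivity)
      -- The factor `(k * m) ^ p = m` lost by averaging the measure over the copies is the factor by
      -- which the normalization of the perimeter grows.
      rw [hsplit, Real.div_rpow (Finset.sum_nonneg fun q _ => hnn q) (by positivity), hp]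
      calc _ ≤ (∑ q : Fin k × Fin m, (m : ℝ) / 2 *
          ((dpow k m hk hm n).edgeVar (fun u => χ (dmk q.1 q.2 u)) / (m : ℝ) ^ n)) / m := by
            gcongr
            exact (rpow_sum_le_sum_rpow _ _ hnn hp0 hp1).trans
              (Finset.sum_le_sum fun q _ => hIH q.1 q.2)
        _ = _ := by
            rw [edgeVar_dpow_succ, ← Finset.mul_sum, ← Finset.sum_div, Fintype.sum_prod_type,
              pow_succ]
            field_simp

end dpow

/-! # Profiles -/

/-- The trapezoid of height `1` and slope `1` over the interval `[0, k]`. -/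
def trapezoid (k : ℕ) (x : ℝ) : ℝ := min (min x (k - x)) 1

theorem trapezoid_zero (k : ℕ) : trapezoid k 0 = 0 := by simp [trapezoid]

theorem trapezoid_self (k : ℕ) : trapezoid k k = 0 := by simp [trapezoid]

theorem abs_trapezoid_sub_le (k : ℕ) (x y : ℝ) :
    |trapezoid k x - trapezoid k y| ≤ |x - y| := by
  have h1 := le_abs_self (x - y)
  have h2 := neg_abs_le (x - y)
  rw [abs_le]
  simp only [trapezoid, min_def]
  constructor <;> split_ifs <;> linarith

theorem trapezoid_nonneg {k : ℕ} {x : ℝ} (h0 : 0 ≤ x) (h1 : x ≤ k) : 0 ≤ trapezoid k x :=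
  le_min (le_min h0 (by linarith)) zero_le_one

theorem trapezoid_le_one (k : ℕ) (x : ℝ) : trapezoid k x ≤ 1 := min_le_right _ _

/-- The first copy contributes at least `x`, the last at least `1 - x`, and each of the `k - 2`
others `1`. -/
theorem le_sum_trapezoid {k : ℕ} (hk : 2 ≤ k) {x : ℝ} (h0 : 0 ≤ x) (h1 : x ≤ 1) :
    (k : ℝ) - 1 ≤ ∑ j : Fin k, trapezoid k (j + x) := by
  let a : Fin k := ⟨0, by omega⟩
  let b : Fin k := ⟨k - 1, by omega⟩
  have h : ∀ j : Fin k, 1 - (if j = a then 1 - x else 0) - (if j = b then x else 0) ≤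
      trapezoid k (j + x) := by
    intro j
    have hab : a ≠ b := by
      simp only [a, b, ne_eq, Fin.mk.injEq]
      omega
    have h2 : (2 : ℝ) ≤ k := by exact_mod_cast hk
    by_cases hja : j = a
    · rw [if_pos hja, if_neg (hja ▸ hab), hja]
      simp only [trapezoid, a, CharP.cast_eq_zero, zero_add, le_min_iff]
      refine ⟨⟨?_, ?_⟩, ?_⟩ <;> linarith
    · have hj0 : (1 : ℝ) ≤ (j : ℕ) := by
        have : (j : ℕ) ≠ 0 := fun h => hja (Fin.ext h)
        exact_mod_cast Nat.one_le_iff_ne_zero.mpr this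
      rw [if_neg hja]
      by_cases hjb : j = b
      · have hjk : ((j : ℕ) : ℝ) + 1 = k := by
          have : (j : ℕ) + 1 = k := by
            rw [hjb]
            simp only [b]
            omega
          exact_mod_cast this
        rw [if_pos hjb]
        simp only [trapezoid, le_min_iff]
        refine ⟨⟨?_, ?_⟩, ?_⟩ <;> linarith
      · have hjk : ((j : ℕ) : ℝ) + 2 ≤ k := by
          have : (j : ℕ) ≠ k - 1 := fun h => hjb (Fin.ext h)
          have : (j : ℕ) + 2 ≤ k := by omega
          exact_mod_cast this
        rw [if_neg hjb]
        simp only [trapezoid, le_min_iff]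
        refine ⟨⟨?_, ?_⟩, ?_⟩ <;> linarith
  refine le_trans (le_of_eq ?_) (Finset.sum_le_sum fun j _ => h j)
  simp only [Finset.sum_sub_distrib, Finset.sum_ite_eq', Finset.mem_univ, if_true]
  simp
  ring

/-- Signs with sum zero on the `m` branches; one of them is zero if `m` is odd. -/
def branchSign (m : ℕ) (i : Fin m) : ℝ :=
  if (i : ℕ) < m / 2 then 1 else if (i : ℕ) < m / 2 + m / 2 then -1 else 0

theorem abs_branchSign_le_one {m : ℕ} (i : Fin m) : |branchSign m i| ≤ 1 := by
  unfold branchSign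
  split_ifs <;> simp

/-- The general `f` serves both the vanishing of the sum and the sum of the absolute values. -/
theorem sum_branchSign_comp {m : ℕ} (f : ℝ → ℝ) : ∑ i, f (branchSign m i) =
    (m / 2 : ℕ) * f 1 + (m / 2 : ℕ) * f (-1) + (m % 2 : ℕ) * f 0 := by
  let g : ℕ → ℝ := fun i => f (if i < m / 2 then 1 else if i < m / 2 + m / 2 then -1 else 0)
  have h1 : ∑ i, f (branchSign m i) = ∑ i ∈ Finset.range m, g i :=
    Fin.sum_univ_eq_sum_range g m
  have h2 : m = m / 2 + m / 2 + m % 2 := by omega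
  rw [h1]
  conv_lhs => rw [h2]
  rw [Finset.sum_range_add, Finset.sum_range_add]
  have h3 : ∀ i ∈ Finset.range (m / 2), g i = f 1 := fun i hi => by
    have := Finset.mem_range.mp hi
    simp [g, this]
  have h4 : ∀ i ∈ Finset.range (m / 2), g (m / 2 + i) = f (-1) := fun i hi => by
    have := Finset.mem_range.mp hi
    simp [g, this]
  have h5 : ∀ i ∈ Finset.range (m % 2), g (m / 2 + m / 2 + i) = f 0 := fun i _ => by
    have : ¬ m / 2 + m / 2 + i < m / 2 := by omega
    simp [g, this]
  rw [Finset.sum_congr rfl h3, Finset.sum_congr rfl h4, Finset.sum_congr rfl h5]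
  simp

theorem sum_branchSign (m : ℕ) : ∑ i, branchSign m i = 0 := by
  rw [sum_branchSign_comp fun x => x]
  ring

/-- At most one branch has sign zero, and only for odd `m`; the worst case is `m = 3`. -/
theorem le_sum_abs_branchSign {m : ℕ} (hm : 2 ≤ m) :
    2 / 3 * (m : ℝ) ≤ ∑ i, |branchSign m i| := by
  rw [sum_branchSign_comp fun x => |x|]
  have : 2 * m ≤ 3 * (m / 2 + m / 2) := by omega
  have : 2 * (m : ℝ) ≤ 3 * ((m / 2 : ℕ) + (m / 2 : ℕ)) := by exact_mod_cast this
  simp only [abs_one, abs_neg, abs_zero, mul_one, mul_zero, add_zero]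
  linarith

section dpow

variable {k m : ℕ} {hk : 2 ≤ k} {hm : 2 ≤ m} {n : ℕ}

/-! # Functions given on the copies -/

/-- The function on the left slash power with the given restrictions to the outermost copies. -/
def dlift (g : Fin k → Fin m → (dpow k m hk hm n).V → ℝ) (x : (dpow k m hk hm (n + 1)).V) : ℝ :=
  let p : (Fin k × Fin m) × (dpow k m hk hm n).V :=
    Quotient.out (s := slashSetoid (diamond k m hk hm).toDirGraph (dpow k m hk hm n)) x
  g p.1.1 p.1.2 p.2

/-- The hypotheses make the chosen representative irrelevant: agreement where consecutive copies
meet, the value `0` at the source, and a value at the sink that does not depend on the branch. The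
height needs the last in this form, since it is `1` there. -/
theorem dlift_dmk {g : Fin k → Fin m → (dpow k m hk hm n).V → ℝ}
    (hglue : ∀ (j j' : Fin k) i, (j : ℕ) + 1 = j' →
      g j i (dpow k m hk hm n).t = g j' i (dpow k m hk hm n).s)
    (hs : ∀ (j : Fin k) i, (j : ℕ) = 0 → g j i (dpow k m hk hm n).s = 0)
    (ht : ∀ (j : Fin k) i i', (j : ℕ) + 1 = k →
      g j i (dpow k m hk hm n).t = g j i' (dpow k m hk hm n).t)
    (j : Fin k) (i : Fin m) (u : (dpow k m hk hm n).V) :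
    dlift g (dmk j i u) = g j i u := by
  unfold dlift
  set p : (Fin k × Fin m) × (dpow k m hk hm n).V :=
    Quotient.out (s := slashSetoid (diamond k m hk hm).toDirGraph (dpow k m hk hm n))
      (dmk j i u) with hp
  have h : dmk p.1.1 p.1.2 p.2 = dmk j i u := Quotient.out_eq
    (s := slashSetoid (diamond k m hk hm).toDirGraph (dpow k m hk hm n)) (dmk j i u)
  change g p.1.1 p.1.2 p.2 = _
  generalize p.1.1 = j', p.1.2 = i', p.2 = u' at h
  rcases dmk_eq h with ⟨rfl, rfl, rfl⟩ | ⟨h1, rfl, rfl, rfl⟩ | ⟨h1, rfl, rfl, rfl⟩ |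
    ⟨h1, h2, rfl, rfl⟩ | ⟨h1, h2, rfl, rfl⟩
  · rfl
  · exact hglue _ _ _ h1
  · exact (hglue _ _ _ h1).symm
  -- Both copies are the last of their branches, so they differ at most in the branch.
  · have : j' = j := Fin.ext (by omega)
    subst this
    exact ht _ _ _ h1
  · rw [hs _ _ h1, hs _ _ h2]

/-- The edge `w` in the copy indexed by the `j`-th edge of the `i`-th path. -/
def dedge (j : Fin k) (i : Fin m) (w : (dpow k m hk hm n).E) : (dpow k m hk hm (n + 1)).E :=
  ((j, i), w)

theorem forall_edge_dpow_succ {P : (dpow k m hk hm (n + 1)).E → Prop}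
    (h : ∀ j i w, P (dedge j i w)) (e : (dpow k m hk hm (n + 1)).E) : P e :=
  h e.1.1 e.1.2 e.2

theorem sum_edge_dpow_succ (f : (dpow k m hk hm (n + 1)).E → ℝ) :
    ∑ e, f e = ∑ j, ∑ i, ∑ w, f (dedge j i w) := by
  refine (Fintype.sum_prod_type _).trans ?_
  exact Fintype.sum_prod_type _

theorem src_dedge (j : Fin k) (i : Fin m) (w : (dpow k m hk hm n).E) :
    (dpow k m hk hm (n + 1)).src (dedge j i w) = dmk j i ((dpow k m hk hm n).src w) := rfl

theorem tgt_dedge (j : Fin k) (i : Fin m) (w : (dpow k m hk hm n).E) :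
    (dpow k m hk hm (n + 1)).tgt (dedge j i w) = dmk j i ((dpow k m hk hm n).tgt w) := rfl

/-- The edge of the graph with one edge. -/
def dedgeZero : (dpow k m hk hm 0).E := ()

theorem sum_edge_dpow_zero (f : (dpow k m hk hm 0).E → ℝ) : ∑ e, f e = f dedgeZero :=
  Fintype.sum_unique (ι := Unit) _

/-! # The height -/

/-- The distance to the source, normalized such that the sink has height `1`. -/
def dheight : (n : ℕ) → (dpow k m hk hm n).V → ℝ
  | 0 => fun u => cond u 1 0
  | n + 1 => dlift fun j _ u => ((j : ℕ) + dheight n u) / k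

/-- The values at the terminals are hypotheses because they are established by an induction that
itself needs this formula. -/
theorem dheight_mk_of (hs : dheight n (dpow k m hk hm n).s = 0)
    (ht : dheight n (dpow k m hk hm n).t = 1) (j : Fin k) (i : Fin m)
    (u : (dpow k m hk hm n).V) :
    dheight (n + 1) (dmk j i u) = ((j : ℕ) + dheight n u) / k := by
  refine dlift_dmk (fun j j' i h => ?_) (fun j i h => ?_) (fun j i i' h => rfl) j i u
  · rw [hs, ht, ← h]
    push_cast
    ring
  · rw [hs, h]
    simp

theorem dheight_source_sink : ∀ n,
    dheight n (dpow k m hk hm n).s = 0 ∧ dheight n (dpow k m hk hm n).t = 1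
  | 0 => ⟨rfl, rfl⟩
  | n + 1 => by
    obtain ⟨hs, ht⟩ := dheight_source_sink n
    constructor
    · rw [← dmk_source (j := ⟨0, by omega⟩) rfl ⟨0, by omega⟩, dheight_mk_of hs ht, hs]
      simp
    · have hk0 : (k : ℝ) ≠ 0 := by
        have : k ≠ 0 := by omega
        exact_mod_cast this
      have h : (((k - 1 : ℕ) : ℝ) + 1) = k := by
        have : k - 1 + 1 = k := by omega
        exact_mod_cast this
      rw [← dmk_sink (j := ⟨k - 1, by omega⟩) (by simp only; omega) ⟨0, by omega⟩,
        dheight_mk_of hs ht, ht]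
      simp only [h]
      exact div_self hk0

theorem dheight_source : dheight n (dpow k m hk hm n).s = 0 := (dheight_source_sink n).1

theorem dheight_sink : dheight n (dpow k m hk hm n).t = 1 := (dheight_source_sink n).2

theorem dheight_dmk (j : Fin k) (i : Fin m) (u : (dpow k m hk hm n).V) :
    dheight (n + 1) (dmk j i u) = ((j : ℕ) + dheight n u) / k :=
  dheight_mk_of dheight_source dheight_sink j i u

theorem dheight_mem : ∀ (n : ℕ) (x : (dpow k m hk hm n).V), dheight n x ∈ Set.Icc (0 : ℝ) 1
  | 0, x => by
    change Bool at x
    cases x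
    · exact ⟨le_refl (0 : ℝ), zero_le_one⟩
    · exact ⟨zero_le_one, le_refl (1 : ℝ)⟩
  | n + 1, x => by
    obtain ⟨j, i, u, rfl⟩ := dmk_surj x
    obtain ⟨h0, h1⟩ := dheight_mem n u
    have hk0 : (0 : ℝ) < k := by
      have : 0 < k := by omega
      exact_mod_cast this
    have hj : ((j : ℕ) : ℝ) + 1 ≤ k := by exact_mod_cast j.2
    rw [dheight_dmk]
    refine ⟨by positivity, ?_⟩
    rw [div_le_one hk0]
    linarith

theorem add_dheight_mem (j : Fin k) (u : (dpow k m hk hm n).V) :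
    0 ≤ (j : ℕ) + dheight n u ∧ (j : ℕ) + dheight n u ≤ k := by
  obtain ⟨h0, h1⟩ := dheight_mem n u
  have hj : ((j : ℕ) : ℝ) + 1 ≤ k := by exact_mod_cast j.2
  exact ⟨by positivity, by linarith⟩

theorem dheight_edge : ∀ (n : ℕ) (e : (dpow k m hk hm n).E),
    dheight n ((dpow k m hk hm n).tgt e) - dheight n ((dpow k m hk hm n).src e) = 1 / (k : ℝ) ^ n
  | 0, e => by
    change (1 : ℝ) - 0 = _
    simp
  | n + 1, e => by
    induction e using forall_edge_dpow_succ with | h j i w => ?_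
    rw [src_dedge, tgt_dedge, dheight_dmk, dheight_dmk, ← sub_div, add_sub_add_left_eq_sub,
      dheight_edge n w, pow_succ, div_div]

/-! # The orthogonal functions -/

/-- The function of level `l` with amplitudes `ε`: on the copy with index `w`, it is the trapezoid of
the height times `ε w` and the sign of the branch. -/
def dwave : (l n : ℕ) → ((dpow k m hk hm l).E → ℝ) → (dpow k m hk hm n).V → ℝ
  | _, 0, _ => fun _ => 0
  | 0, n + 1, ε => dlift fun j i u =>
      ε dedgeZero * (branchSign m i * trapezoid k ((j : ℕ) + dheight n u))
  | l + 1, n + 1, ε => dlift fun j i u => dwave l n (fun w => ε (dedge j i w)) u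

theorem dwave_zero_dmk (ε : (dpow k m hk hm 0).E → ℝ) (j : Fin k) (i : Fin m)
    (u : (dpow k m hk hm n).V) : dwave 0 (n + 1) ε (dmk j i u) =
      ε dedgeZero * (branchSign m i * trapezoid k ((j : ℕ) + dheight n u)) := by
  rw [dwave]
  refine dlift_dmk (fun j j' i h => ?_) (fun j i h => ?_) (fun j i i' h => ?_) j i u
  · rw [dheight_source, dheight_sink, ← h]
    simp
  · rw [dheight_source, h]
    simp [trapezoid_zero]
  · have h' : ((j : ℕ) : ℝ) + 1 = k := by exact_mod_cast h
    rw [dheight_sink, h', trapezoid_self]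
    simp

/-- Waves in different copies fit together because they vanish at all terminals; this vanishing is a
hypothesis here, as its inductive proof uses the formula. -/
theorem dwave_succ_dmk_of {l : ℕ}
    (h : ∀ ε : (dpow k m hk hm l).E → ℝ, dwave l n ε (dpow k m hk hm n).s = 0 ∧
      dwave l n ε (dpow k m hk hm n).t = 0)
    (ε : (dpow k m hk hm (l + 1)).E → ℝ) (j : Fin k) (i : Fin m) (u : (dpow k m hk hm n).V) :
    dwave (l + 1) (n + 1) ε (dmk j i u) = dwave l n (fun w => ε (dedge j i w)) u := by
  rw [dwave]
  exact dlift_dmk (fun j j' i _ => by rw [(h _).1, (h _).2]) (fun j i _ => (h _).1)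
    (fun j i i' _ => by rw [(h _).2, (h _).2]) j i u

theorem dwave_source_sink : ∀ (l n : ℕ) (ε : (dpow k m hk hm l).E → ℝ),
    dwave l n ε (dpow k m hk hm n).s = 0 ∧ dwave l n ε (dpow k m hk hm n).t = 0
  | _, 0, _ => by simp [dwave]
  | 0, n + 1, ε => by
    constructor
    · rw [← dmk_source (j := ⟨0, by omega⟩) rfl ⟨0, by omega⟩, dwave_zero_dmk, dheight_source]
      simp [trapezoid_zero]
    · have h : (((k - 1 : ℕ) : ℝ) + 1) = k := by
        have : k - 1 + 1 = k := by omega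
        exact_mod_cast this
      rw [← dmk_sink (j := ⟨k - 1, by omega⟩) (by simp only; omega) ⟨0, by omega⟩,
        dwave_zero_dmk, dheight_sink]
      simp only [h, trapezoid_self]
      simp
  | l + 1, n + 1, ε => by
    have ih := dwave_source_sink l n
    constructor
    · rw [← dmk_source (j := ⟨0, by omega⟩) rfl ⟨0, by omega⟩, dwave_succ_dmk_of ih, (ih _).1]
    · rw [← dmk_sink (j := ⟨k - 1, by omega⟩) (by simp only; omega) ⟨0, by omega⟩,
        dwave_succ_dmk_of ih, (ih _).2]

theorem dwave_succ_dmk {l : ℕ} (ε : (dpow k m hk hm (l + 1)).E → ℝ) (j : Fin k) (i : Fin m)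
    (u : (dpow k m hk hm n).V) :
    dwave (l + 1) (n + 1) ε (dmk j i u) = dwave l n (fun w => ε (dedge j i w)) u :=
  dwave_succ_dmk_of (dwave_source_sink l n) ε j i u

theorem abs_dwave_le_one : ∀ (l n : ℕ) (ε : (dpow k m hk hm l).E → ℝ), (∀ w, |ε w| ≤ 1) →
    ∀ x : (dpow k m hk hm n).V, |dwave l n ε x| ≤ 1
  | _, 0, _ => by simp [dwave]
  | 0, n + 1, ε => by
    intro hε x
    obtain ⟨j, i, u, rfl⟩ := dmk_surj x
    rw [dwave_zero_dmk, abs_mul, abs_mul, abs_of_nonneg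
      (trapezoid_nonneg (add_dheight_mem j u).1 (add_dheight_mem j u).2)]
    exact mul_le_one₀ (hε _) (mul_nonneg (abs_nonneg _)
      (trapezoid_nonneg (add_dheight_mem j u).1 (add_dheight_mem j u).2))
      (mul_le_one₀ (abs_branchSign_le_one i)
      (trapezoid_nonneg (add_dheight_mem j u).1 (add_dheight_mem j u).2) (trapezoid_le_one _ _))
  | l + 1, n + 1, ε => by
    intro hε x
    obtain ⟨j, i, u, rfl⟩ := dmk_surj x
    rw [dwave_succ_dmk]
    exact abs_dwave_le_one l n _ (fun w => hε _) u

/-- At level `0` the trapezoid has slope at most `1` in `k` times the height, and an edge changes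
the height by `k⁻ⁿ`. Each further level raises both exponents by one and leaves the quotient
unchanged. -/
theorem abs_dwave_edge_le : ∀ (l n : ℕ) (ε : (dpow k m hk hm l).E → ℝ), (∀ w, |ε w| ≤ 1) →
    ∀ e : (dpow k m hk hm n).E, |dwave l n ε ((dpow k m hk hm n).tgt e) -
      dwave l n ε ((dpow k m hk hm n).src e)| ≤ (k : ℝ) ^ (l + 1) / (k : ℝ) ^ n
  | _, 0, _ => by
    intro _ e
    simp only [dwave, sub_self, abs_zero]
    positivity
  | 0, n + 1, ε => by
    intro hε e
    induction e using forall_edge_dpow_succ with | h j i w => ?_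
    have hk0 : (0 : ℝ) < k := by
      have : 0 < k := by omega
      exact_mod_cast this
    rw [src_dedge, tgt_dedge, dwave_zero_dmk, dwave_zero_dmk, ← mul_sub, ← mul_sub, abs_mul,
      abs_mul]
    have h1 := abs_trapezoid_sub_le k ((j : ℕ) + dheight n ((dpow k m hk hm n).tgt w))
      ((j : ℕ) + dheight n ((dpow k m hk hm n).src w))
    rw [add_sub_add_left_eq_sub, dheight_edge,
      abs_of_pos (by positivity : (0 : ℝ) < 1 / (k : ℝ) ^ n)] at h1
    calc _ ≤ 1 * (1 * (1 / (k : ℝ) ^ n)) := by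
          gcongr
          · exact hε _
          · exact abs_branchSign_le_one i
      _ = _ := by
          rw [zero_add, pow_one, pow_succ]
          field_simp
  | l + 1, n + 1, ε => by
    intro hε e
    induction e using forall_edge_dpow_succ with | h j i w => ?_
    have hk0 : (0 : ℝ) < k := by
      have : 0 < k := by omega
      exact_mod_cast this
    rw [src_dedge, tgt_dedge, dwave_succ_dmk, dwave_succ_dmk]
    refine (abs_dwave_edge_le l n _ (fun w => hε _) w).trans (le_of_eq ?_)
    rw [pow_succ _ (l + 1), pow_succ _ n, mul_div_mul_right _ _ hk0.ne']

/-- The functions are orthogonal to every function of the height. -/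
theorem edgeSum_dwave_mul_dheight : ∀ (l n : ℕ) (ε : (dpow k m hk hm l).E → ℝ) (φ : ℝ → ℝ),
    (dpow k m hk hm n).edgeSum (fun x => dwave l n ε x * φ (dheight n x)) = 0
  | _, 0, _, _ => by simp [dwave, DirGraph.edgeSum]
  | 0, n + 1, ε, φ => by
    rw [edgeSum_dpow_succ]
    refine Finset.sum_eq_zero fun j _ => ?_
    -- The branch enters only through its sign, so summing over the branches gives the factor zero.
    have h : ∀ i, (dpow k m hk hm n).edgeSum (fun u => dwave 0 (n + 1) ε (dmk j i u) *
        φ (dheight (n + 1) (dmk j i u))) = branchSign m i * (dpow k m hk hm n).edgeSum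
        fun u => ε dedgeZero * trapezoid k ((j : ℕ) + dheight n u) *
          φ (((j : ℕ) + dheight n u) / k) := by
      intro i
      rw [← DirGraph.edgeSum_mul_left]
      congr 1
      funext u
      rw [dwave_zero_dmk, dheight_dmk]
      ring
    rw [Finset.sum_congr rfl fun i _ => h i, ← Finset.sum_mul, sum_branchSign, zero_mul]
  | l + 1, n + 1, ε, φ => by
    rw [edgeSum_dpow_succ]
    refine Finset.sum_eq_zero fun j _ => Finset.sum_eq_zero fun i _ => ?_
    simp only [dwave_succ_dmk, dheight_dmk]
    -- A function of the height restricts on a copy to a function of the height of that copy; this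
    -- is why `φ` is arbitrary.
    exact edgeSum_dwave_mul_dheight l n _ fun x => φ (((j : ℕ) + x) / k)

/-- Functions of different levels are orthogonal. -/
theorem edgeSum_dwave_mul_dwave_of_lt : ∀ (l l' n : ℕ), l < l' →
    ∀ (ε : (dpow k m hk hm l).E → ℝ) (ε' : (dpow k m hk hm l').E → ℝ),
    (dpow k m hk hm n).edgeSum (fun x => dwave l' n ε' x * dwave l n ε x) = 0
  | _, _, 0, _, _, _ => by simp [dwave, DirGraph.edgeSum]
  | 0, l' + 1, n + 1, _, ε, ε' => by
    rw [edgeSum_dpow_succ]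
    refine Finset.sum_eq_zero fun j _ => Finset.sum_eq_zero fun i _ => ?_
    simp only [dwave_succ_dmk, dwave_zero_dmk]
    -- On one copy the sign of the branch is fixed, and the coarser wave is a function of the
    -- height.
    exact edgeSum_dwave_mul_dheight l' n _ fun x =>
      ε dedgeZero * (branchSign m i * trapezoid k ((j : ℕ) + x))
  | l + 1, l' + 1, n + 1, h, ε, ε' => by
    rw [edgeSum_dpow_succ]
    refine Finset.sum_eq_zero fun j _ => Finset.sum_eq_zero fun i _ => ?_
    simp only [dwave_succ_dmk]
    exact edgeSum_dwave_mul_dwave_of_lt l l' n (by omega) _ _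

/-- The inner product of two functions of the same level is a multiple of the inner product of the
amplitudes. -/
theorem exists_edgeSum_dwave_mul_dwave : ∀ (l n : ℕ), ∃ c : ℝ,
    ∀ (ε ε' : (dpow k m hk hm l).E → ℝ),
    (dpow k m hk hm n).edgeSum (fun x => dwave l n ε x * dwave l n ε' x) =
      (∑ w, ε w * ε' w) * c
  | _, 0 => ⟨0, fun _ _ => by simp [dwave, DirGraph.edgeSum]⟩
  | 0, n + 1 => by
    refine ⟨∑ j : Fin k, ∑ i : Fin m, (dpow k m hk hm n).edgeSum fun u =>
      (branchSign m i * trapezoid k ((j : ℕ) + dheight n u)) ^ 2, fun ε ε' => ?_⟩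
    rw [edgeSum_dpow_succ, sum_edge_dpow_zero, Finset.mul_sum]
    refine Finset.sum_congr rfl fun j _ => ?_
    rw [Finset.mul_sum]
    refine Finset.sum_congr rfl fun i _ => ?_
    rw [← DirGraph.edgeSum_mul_left]
    congr 1
    funext u
    rw [dwave_zero_dmk, dwave_zero_dmk]
    ring
  | l + 1, n + 1 => by
    obtain ⟨c, hc⟩ := exists_edgeSum_dwave_mul_dwave l n
    -- All copies are alike, so they share the same constant.
    refine ⟨c, fun ε ε' => ?_⟩
    rw [edgeSum_dpow_succ, sum_edge_dpow_succ, Finset.sum_mul]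
    refine Finset.sum_congr rfl fun j _ => ?_
    rw [Finset.sum_mul]
    refine Finset.sum_congr rfl fun i _ => ?_
    simp only [dwave_succ_dmk]
    exact hc _ _

/-- Up to normalization, this bounds the `L₁` norm below by `1 / 3` of the mean of `|ε|`: the
trapezoid has mean at least `1 / 2` and the branch signs have mean absolute value at least `2 / 3`.
-/
theorem le_edgeSum_abs_dwave : ∀ (l n : ℕ), l < n → ∀ ε : (dpow k m hk hm l).E → ℝ,
    2 / 3 * ((k : ℝ) * m) ^ n * ∑ w, |ε w| ≤
      ((k : ℝ) * m) ^ l * (dpow k m hk hm n).edgeSum fun x => |dwave l n ε x|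
  | 0, n + 1, _, ε => by
    have h : ∀ j i, (dpow k m hk hm n).edgeSum (fun u => |dwave 0 (n + 1) ε (dmk j i u)|) =
        |ε dedgeZero| * |branchSign m i| * (dpow k m hk hm n).edgeSum
          (fun u => trapezoid k ((j : ℕ) + dheight n u)) := by
      intro j i
      rw [← DirGraph.edgeSum_mul_left]
      congr 1
      funext u
      rw [dwave_zero_dmk, abs_mul, abs_mul, abs_of_nonneg
        (trapezoid_nonneg (add_dheight_mem j u).1 (add_dheight_mem j u).2), mul_assoc]
    -- Here the bound `k - 1` for the sum of the trapezoids is weakened to `k / 2`, which uses `k ≥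
    -- 2`.
    have h1 : 2 * ((k : ℝ) * m) ^ n * (k / 2) ≤ ∑ j : Fin k, (dpow k m hk hm n).edgeSum
        (fun u => trapezoid k ((j : ℕ) + dheight n u)) := by
      have hk2 : (2 : ℝ) ≤ k := by exact_mod_cast hk
      rw [← DirGraph.edgeSum_sum]
      refine le_trans (le_of_eq ?_) (DirGraph.edgeSum_mono _ (φ := fun _ => (k : ℝ) / 2)
        fun x => le_trans ?_ (le_sum_trapezoid hk (dheight_mem n x).1 (dheight_mem n x).2))
      · rw [DirGraph.edgeSum_const, card_dpow_edge]
        push_cast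
        ring
      · linarith
    have h2 := le_sum_abs_branchSign hm
    rw [edgeSum_dpow_succ, sum_edge_dpow_zero, pow_zero, one_mul]
    simp only [h]
    have h3 : ∀ j : Fin k, ∑ i, |ε dedgeZero| * |branchSign m i| * (dpow k m hk hm n).edgeSum
          (fun u => trapezoid k ((j : ℕ) + dheight n u)) = |ε dedgeZero| *
          (∑ i, |branchSign m i|) * (dpow k m hk hm n).edgeSum
          (fun u => trapezoid k ((j : ℕ) + dheight n u)) := by
      intro j
      rw [Finset.mul_sum, Finset.sum_mul]
    rw [Finset.sum_congr rfl fun j _ => h3 j, ← Finset.mul_sum]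
    calc _ = |ε dedgeZero| * (2 / 3 * (m : ℝ)) * (2 * ((k : ℝ) * m) ^ n * (k / 2)) := by ring
      _ ≤ _ := by gcongr
  | l + 1, n + 1, h, ε => by
    have ih := le_edgeSum_abs_dwave l n (by omega)
    rw [edgeSum_dpow_succ, sum_edge_dpow_succ]
    simp only [dwave_succ_dmk]
    calc _ = (k : ℝ) * m * ∑ j, ∑ i, (2 / 3 * ((k : ℝ) * m) ^ n *
          ∑ w, |ε (dedge j i w)|) := by
          simp only [← Finset.mul_sum]
          ring
      _ ≤ (k : ℝ) * m * ∑ j, ∑ i, (((k : ℝ) * m) ^ l * (dpow k m hk hm n).edgeSum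
          fun x => |dwave l n (fun w => ε (dedge j i w)) x|) := by
          exact mul_le_mul_of_nonneg_left (Finset.sum_le_sum fun j _ =>
            Finset.sum_le_sum fun i _ => ih _) (by positivity)
      _ = _ := by
          simp only [← Finset.mul_sum]
          ring

end dpow

/-! # Walsh functions -/

/-- The Walsh functions. -/
def walsh {r : ℕ} (a b : Fin r → Bool) : ℝ := ∏ i, if a i && b i then -1 else 1

theorem abs_walsh {r : ℕ} (a b : Fin r → Bool) : |walsh a b| = 1 := by
  rw [walsh, Finset.abs_prod]
  refine Finset.prod_eq_one fun i _ => ?_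
  split_ifs <;> simp

/-- The sum factors over the coordinates, and a coordinate in which `a` and `a'` differ contributes
`1 - 1`. -/
theorem sum_walsh_mul_walsh {r : ℕ} {a a' : Fin r → Bool} (h : a ≠ a') :
    ∑ b, walsh a b * walsh a' b = 0 := by
  have h1 := Finset.prod_univ_sum (fun _ : Fin r => (Finset.univ : Finset Bool))
    (fun i c => ((if a i && c then -1 else 1) * (if a' i && c then -1 else 1) : ℝ))
  rw [Fintype.piFinset_univ] at h1
  simp only [walsh, ← Finset.prod_mul_distrib]
  rw [← h1]
  obtain ⟨i, hi⟩ := Function.ne_iff.mp h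
  refine Finset.prod_eq_zero (Finset.mem_univ i) ?_
  rw [Fintype.sum_bool]
  cases h2 : a i <;> cases h3 : a' i <;> simp_all

/-- On a set with at least `2 ^ r` points there are `2 ^ r` orthogonal functions whose values are
signs on `2 ^ r` points and zero elsewhere. -/
theorem exists_orthogonal_signs (E : Type) [Fintype E] {r : ℕ} (h : 2 ^ r ≤ Fintype.card E) :
    ∃ W : (Fin r → Bool) → E → ℝ, (∀ a w, |W a w| ≤ 1) ∧ (∀ a, ∑ w, |W a w| = 2 ^ r) ∧
      ∀ a a', a ≠ a' → ∑ w, W a w * W a' w = 0 := by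
  -- The Walsh functions are transported to `2 ^ r` points of `E` and extended by zero, which
  -- changes no sum.
  obtain ⟨ι⟩ : Nonempty ((Fin r → Bool) ↪ E) :=
    Function.Embedding.nonempty_of_card_le (by simpa using h)
  have hout : ∀ a, ∀ w ∉ Set.range ι, Function.extend ι (walsh a) 0 w = 0 := fun a w hw =>
    Function.extend_apply' _ _ _ hw
  have hin : ∀ a b, Function.extend ι (walsh a) 0 (ι b) = walsh a b := fun a b =>
    ι.injective.extend_apply _ _ _
  refine ⟨fun a => Function.extend ι (walsh a) 0, fun a w => ?_, fun a => ?_, fun a a' haa' => ?_⟩ <;>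
    beta_reduce
  · by_cases hw : w ∈ Set.range ι
    · obtain ⟨b, rfl⟩ := hw
      rw [hin, abs_walsh]
    · rw [hout a w hw]
      simp
  · rw [← Fintype.sum_of_injective ι ι.injective (fun _ => 1) _
      (fun w hw => by rw [hout a w hw, abs_zero]) (fun b => by rw [hin, abs_walsh])]
    simp
  · rw [← Fintype.sum_of_injective ι ι.injective (fun b => walsh a b * walsh a' b) _
      (fun w hw => by rw [hout a w hw, zero_mul]) (fun b => by rw [hin, hin])]
    exact sum_walsh_mul_walsh haa'

/-! # Norms and Lipschitz constants on graphs -/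

namespace DirGraph

variable (G : DirGraph)

theorem dist_src_tgt (e : G.E) : G.toSimple.dist (G.src e) (G.tgt e) = 1 :=
  SimpleGraph.dist_eq_one_iff_adj.mpr ⟨G.loopless e, Or.inl ⟨e, rfl, rfl⟩⟩

theorem abs_sub_le_of_edge {f : G.V → ℝ} {c : ℝ}
    (h : ∀ e, |f (G.tgt e) - f (G.src e)| ≤ c) {x y : G.V} (p : G.toSimple.Walk x y) :
    |f x - f y| ≤ c * p.length := by
  induction p with
  | nil => simp
  | @cons u v w hadj p ih =>
    have h1 : |f u - f v| ≤ c := by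
      obtain ⟨-, ⟨e, rfl, rfl⟩ | ⟨e, rfl, rfl⟩⟩ := hadj
      · rw [abs_sub_comm]
        exact h e
      · exact h e
    rw [SimpleGraph.Walk.length_cons]
    push_cast
    linarith [abs_sub_le (f u) (f v) (f w)]

/-- In a path metric it suffices to control the increments along edges, by summing them over a
shortest walk. -/
theorem lipConst_pathMetric_le {ℓ : ℝ} (hℓ : 0 < ℓ) {f : G.V → ℝ} {L : ℝ} (hL : 0 ≤ L)
    (h : ∀ e, |f (G.tgt e) - f (G.src e)| ≤ L * ℓ) : lipConst (G.pathMetric ℓ hℓ) f ≤ L := by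
  refine Real.iSup_le (fun p => ?_) hL
  obtain ⟨w, hw⟩ := G.toSimple_connected.exists_walk_length_eq_dist p.1 p.2
  have h1 := G.abs_sub_le_of_edge h w
  rw [hw] at h1
  change _ / (ℓ * (G.toSimple.dist p.1 p.2 : ℝ)) ≤ L
  refine div_le_of_le_mul₀ (by positivity) hL ?_
  linarith

open Classical in
theorem perimeter_pathMetric {ℓ : ℝ} (hℓ : 0 < ℓ) (A : Finset G.V) (χ : G.V → ℝ)
    (hχ : ∀ x, χ x = if x ∈ A then 1 else 0) :
    G.perimeter G.uniformEdge (G.pathMetric ℓ hℓ) A =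
      G.edgeVar χ / (Fintype.card G.E * ℓ) := by
  have h1 : ∀ e, G.uniformEdge.1 e / (G.pathMetric ℓ hℓ).dist (G.src e) (G.tgt e) =
      1 / (Fintype.card G.E * ℓ) := by
    intro e
    change 1 / (Fintype.card G.E : ℝ) / (ℓ * (G.toSimple.dist (G.src e) (G.tgt e) : ℝ)) = _
    rw [G.dist_src_tgt e, Nat.cast_one, mul_one, div_div]
  rw [perimeter, Finset.sum_congr rfl fun e _ => h1 e, edgeBoundary, Finset.sum_filter, edgeVar,
    Finset.sum_div]
  refine Finset.sum_congr rfl fun e _ => ?_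
  rw [hχ, hχ]
  by_cases h2 : G.src e ∈ A <;> by_cases h3 : G.tgt e ∈ A <;> simp [h2, h3]

open Classical in
theorem meas_degreeProb (A : Finset G.V) (χ : G.V → ℝ)
    (hχ : ∀ x, χ x = if x ∈ A then 1 else 0) :
    G.degreeProb.meas A = G.edgeSum χ / (2 * Fintype.card G.E) := by
  rw [← sum_degreeProb_mul, ProbMass.meas, ← Finset.sum_subset (Finset.subset_univ A)]
  · exact Finset.sum_congr rfl fun x hx => by rw [hχ, if_pos hx, mul_one]
  · intro x _ hx
    rw [hχ, if_neg hx, mul_zero]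

theorem normLinf_le {μ : ProbMass G.V} {f : G.V → ℝ} (h : ∀ x, |f x| ≤ 1) :
    μ.normLinf f ≤ 1 :=
  Real.iSup_le (fun _ => h _) zero_le_one

end DirGraph

/-! # The diamond graphs -/

section exponent

variable {k m : ℕ}

theorem rpow_one_add_log_div_log (hk : 2 ≤ k) (hm : 2 ≤ m) :
    (k : ℝ) ^ (1 + Real.log m / Real.log k) = (k : ℝ) * m := by
  have hk2 : (2 : ℝ) ≤ k := by exact_mod_cast hk
  have hm2 : (2 : ℝ) ≤ m := by exact_mod_cast hm
  rw [Real.rpow_add (by linarith), Real.rpow_one]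
  congr 1
  exact Real.rpow_logb (by linarith) (by linarith) (by linarith)

theorem log_div_log_pos (hk : 2 ≤ k) (hm : 2 ≤ m) : 0 < Real.log m / Real.log k := by
  have hk2 : (2 : ℝ) ≤ k := by exact_mod_cast hk
  have hm2 : (2 : ℝ) ≤ m := by exact_mod_cast hm
  exact div_pos (Real.log_pos (by linarith)) (Real.log_pos (by linarith))

/-- Since `k ^ δ = k * m`, the left side is `k ^ (δ - 1) = m`. -/
theorem mul_rpow_eq (hk : 2 ≤ k) (hm : 2 ≤ m) :
    ((k : ℝ) * m) ^ ((1 + Real.log m / Real.log k - 1) / (1 + Real.log m / Real.log k)) = m := by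
  have hk2 : (2 : ℝ) ≤ k := by exact_mod_cast hk
  have hm2 : (2 : ℝ) ≤ m := by exact_mod_cast hm
  have h := log_div_log_pos hk hm
  rw [← rpow_one_add_log_div_log hk hm, ← Real.rpow_mul (by linarith),
    mul_div_cancel₀ _ (by linarith), add_sub_cancel_left]
  exact Real.rpow_logb (by linarith) (by linarith) (by linarith)

end exponent

variable {k m : ℕ} {hk : 2 ≤ k} {hm : 2 ≤ m} {n : ℕ}

theorem card_edge_of_iso {G : STGraph} (φ : STGraph.Iso G (dpow k m hk hm n)) :
    (Fintype.card G.E : ℝ) = ((k : ℝ) * m) ^ n := by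
  rw [Fintype.card_congr φ.e, card_dpow_edge]
  push_cast
  rfl

/-! ### The two properties for graphs isomorphic to a left slash power -/

theorem STGraph.Iso.hasIsoperimetricDimension {G : STGraph}
    (φ : STGraph.Iso G (dpow k m hk hm n)) (hℓ : 0 < ((k : ℝ) ^ n)⁻¹) :
    G.HasIsoperimetricDimension G.degreeProb G.uniformEdge (G.pathMetric _ hℓ)
      (1 + Real.log m / Real.log k) ((m : ℝ) / 2) := by
  classical
  have hk2 : (2 : ℝ) ≤ k := by exact_mod_cast hk
  have hm2 : (2 : ℝ) ≤ m := by exact_mod_cast hm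
  have hδ := log_div_log_pos hk hm
  refine ⟨by linarith, by linarith, G.pathMetric_isGeodesic _ hℓ, fun A => ?_⟩
  have hp := mul_rpow_eq hk hm
  set p := (1 + Real.log m / Real.log k - 1) / (1 + Real.log m / Real.log k) with hpdef
  have hp0 : 0 < p := div_pos (by linarith) (by linarith)
  have hp1 : p ≤ 1 := (div_le_one (by linarith)).mpr (by linarith)
  have hper : ∀ B : Finset G.V, ∀ χ : (dpow k m hk hm n).V → ℝ,
      (∀ x, χ x = if φ.v.symm x ∈ B then 1 else 0) →
      G.perimeter G.uniformEdge (G.pathMetric _ hℓ) B =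
        (dpow k m hk hm n).edgeVar χ / (m : ℝ) ^ n := by
    intro B χ hχ
    rw [G.perimeter_pathMetric hℓ B (fun x => χ (φ.v x)) (fun x => by simp [hχ]),
      φ.edgeVar_comp, card_edge_of_iso φ, mul_pow]
    congr 1
    -- The number of edges times the edge length is `(k * m) ^ n * k⁻ⁿ = m ^ n`.
    field_simp
  have hmeas : ∀ B : Finset G.V, ∀ χ : (dpow k m hk hm n).V → ℝ,
      (∀ x, χ x = if φ.v.symm x ∈ B then 1 else 0) →
      G.degreeProb.meas B = (dpow k m hk hm n).edgeSum χ / (2 * ((k : ℝ) * m) ^ n) := by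
    intro B χ hχ
    rw [G.meas_degreeProb B (fun x => χ (φ.v x)) (fun x => by simp [hχ]),
      φ.edgeSum_comp, card_edge_of_iso φ]
  have hmeas0 : ∀ B : Finset G.V, 0 ≤ G.degreeProb.meas B := fun B =>
    Finset.sum_nonneg fun x _ => G.degreeProb.2.1 x
  have hmin0 : 0 ≤ min (G.degreeProb.meas A) (G.degreeProb.meas Aᶜ) :=
    le_min (hmeas0 _) (hmeas0 _)
  have key : ∀ B : Finset G.V, φ.v.symm (dpow k m hk hm n).s ∉ B →
      φ.v.symm (dpow k m hk hm n).t ∉ B → G.degreeProb.meas B ^ p ≤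
        (m : ℝ) / 2 * G.perimeter G.uniformEdge (G.pathMetric _ hℓ) B := by
    intro B hs ht
    let χ : (dpow k m hk hm n).V → ℝ := fun x => if φ.v.symm x ∈ B then 1 else 0
    rw [hper B χ fun _ => rfl, hmeas B χ fun _ => rfl]
    refine dpow_isoperimetric hp0 hp1 hp n χ (fun x => ?_) (if_neg hs) (if_neg ht)
    simp only [χ]
    split_ifs <;> simp
  by_cases hs : φ.v.symm (dpow k m hk hm n).s ∈ A <;>
    by_cases ht : φ.v.symm (dpow k m hk hm n).t ∈ A
  -- Both terminals lie in `A`: the complement contains neither and has the same boundary.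
  · have hbd : G.edgeBoundary Aᶜ = G.edgeBoundary A := by
      ext e
      simp only [DirGraph.edgeBoundary, Finset.mem_filter, Finset.mem_univ, true_and,
        Finset.mem_compl]
      tauto
    have h1 := key Aᶜ (by simpa using hs) (by simpa using ht)
    rw [DirGraph.perimeter, hbd] at h1
    exact (Real.rpow_le_rpow hmin0 (by convert min_le_right _ _) hp0.le).trans h1
  rotate_left 2
  · exact (Real.rpow_le_rpow hmin0 (min_le_left _ _) hp0.le).trans (key A hs ht)
  -- In the two remaining cases `A` separates the terminals. The perimeter is then at least `1`, and
  -- `m / 2 ≥ 1` suffices.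
  all_goals
    let χ : (dpow k m hk hm n).V → ℝ := fun x => if φ.v.symm x ∈ A then 1 else 0
    have h1 := le_edgeVar_dpow n χ
    have h2 : |χ (dpow k m hk hm n).t - χ (dpow k m hk hm n).s| = 1 := by simp [χ, hs, ht]
    rw [h2, mul_one] at h1
    rw [hper A χ fun _ => rfl]
    have h3 : G.degreeProb.meas A ≤ 1 := by
      rw [hmeas A χ fun _ => rfl]
      refine edgeSum_dpow_div_le_one fun x => ?_
      simp only [χ]
      split_ifs <;> simp
    calc _ ≤ (1 : ℝ) := Real.rpow_le_one hmin0 ((min_le_left _ _).trans h3) hp0.le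
      _ ≤ (m : ℝ) / 2 * 1 := by linarith
      _ ≤ _ := by
        gcongr
        rw [one_le_div (by positivity)]
        exact h1

theorem STGraph.Iso.hasLipschitzSpectralProfile {G : STGraph}
    (φ : STGraph.Iso G (dpow k m hk hm n)) (hℓ : 0 < ((k : ℝ) ^ n)⁻¹) :
    G.HasLipschitzSpectralProfile G.degreeProb (G.pathMetric _ hℓ)
      (1 + Real.log m / Real.log k) ((k : ℝ) ^ n) 6 1 (2 * (k : ℝ) ^ 2 * (m : ℝ) ^ 2) := by
  have hk2 : (2 : ℝ) ≤ k := by exact_mod_cast hk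
  have hm2 : (2 : ℝ) ≤ m := by exact_mod_cast hm
  have hk1 : (1 : ℝ) ≤ k := by linarith
  have hδ := log_div_log_pos hk hm
  have hkδ := rpow_one_add_log_div_log hk hm
  set δ := 1 + Real.log m / Real.log k with hδdef
  have hδ1 : 1 ≤ δ := by linarith
  refine ⟨hδ1, one_le_pow₀ hk1, by norm_num, by norm_num, by positivity, ?_⟩
  -- The largest exponent with `2 ^ r l ≤ (k * m) ^ l`. Walsh functions come in powers of two, which
  -- costs at most a factor `2` in the support and in the number of functions.
  let r : ℕ → ℕ := fun l => Nat.log 2 ((k * m) ^ l)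
  have hkm0 : ∀ l, (k * m) ^ l ≠ 0 := fun l => by
    have : 0 < k * m := Nat.mul_pos (by omega) (by omega)
    positivity
  have hrlt : ∀ l, ((k : ℝ) * m) ^ l < 2 ^ r l * 2 := fun l => by
    have := Nat.lt_pow_succ_log_self (b := 2) (by norm_num) ((k * m) ^ l)
    rw [Nat.succ_eq_add_one, pow_succ] at this
    exact_mod_cast this
  have hW : ∀ l, ∃ W : (Fin (r l) → Bool) → (dpow k m hk hm l).E → ℝ, (∀ a w, |W a w| ≤ 1) ∧
      (∀ a, ∑ w, |W a w| = 2 ^ r l) ∧ ∀ a a', a ≠ a' → ∑ w, W a w * W a' w = 0 := fun l =>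
    exists_orthogonal_signs _ (by
      rw [card_dpow_edge]
      exact Nat.pow_log_le_self 2 (hkm0 l))
  choose W hW1 hW2 hW3 using hW
  -- The constant function `1`, together with the waves of all levels below `n` with Walsh
  -- amplitudes.
  let F : Option (Σ l : Fin n, (Fin (r l) → Bool)) → G.V → ℝ := fun q x =>
    q.elim 1 fun a => dwave a.1 n (W a.1 a.2) (φ.v x)
  have hcard : (Fintype.card G.E : ℝ) = ((k : ℝ) * m) ^ n := card_edge_of_iso φ
  have hinner : ∀ f g : (dpow k m hk hm n).V → ℝ,
      (dpow k m hk hm n).edgeSum (fun x => f x * g x) = 0 →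
      G.degreeProb.innerL2 (fun x => f (φ.v x)) (fun x => g (φ.v x)) = 0 := by
    intro f g h
    rw [ProbMass.innerL2, G.sum_degreeProb_mul (fun x => f (φ.v x) * g (φ.v x)),
      φ.edgeSum_comp (fun x => f x * g x), h, zero_div]
  have hcomm : ∀ f g : G.V → ℝ, G.degreeProb.innerL2 f g = G.degreeProb.innerL2 g f :=
    fun f g => Finset.sum_congr rfl fun x _ => by rw [mul_comm (f x)]
  have hconst : ∀ a, G.degreeProb.innerL2 (F (some a)) (F none) = 0 := fun a =>
    hinner (dwave a.1 n (W a.1 a.2)) (fun _ => 1) (edgeSum_dwave_mul_dheight _ _ _ fun _ => 1)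
  have hlt : ∀ a b : Σ l : Fin n, (Fin (r l) → Bool), a.1 < b.1 →
      G.degreeProb.innerL2 (F (some b)) (F (some a)) = 0 := fun a b hab =>
    hinner (dwave b.1 n (W b.1 b.2)) (dwave a.1 n (W a.1 a.2))
      (edgeSum_dwave_mul_dwave_of_lt _ _ _ hab _ _)
  have hlip : ∀ a, lipConst (G.pathMetric _ hℓ) (F (some a)) ≤ (k : ℝ) ^ ((a.1 : ℕ) + 1) := by
    intro a
    refine G.lipConst_pathMetric_le hℓ (by positivity) fun e => ?_
    have h := abs_dwave_edge_le a.1 n (W a.1 a.2) (hW1 _ _) (φ.e e)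
    rw [φ.src_eq, φ.tgt_eq] at h
    rw [← div_eq_mul_inv]
    exact h
  refine ⟨Option (Σ l : Fin n, (Fin (r l) → Bool)), F, ?_, ?_, ?_, ?_⟩
  · rintro (_ | a)
    · have h : G.degreeProb.normL1 (F none) = 1 := by
        simpa [ProbMass.normL1, F] using G.degreeProb.2.2
      rw [h]
      norm_num
    · have h1 : G.degreeProb.normL1 (F (some a)) =
          (dpow k m hk hm n).edgeSum (fun x => |dwave a.1 n (W a.1 a.2) x|) /
            (2 * ((k : ℝ) * m) ^ n) := by
        rw [ProbMass.normL1, G.sum_degreeProb_mul, hcard, ← φ.edgeSum_comp]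
        rfl
      have h2 := le_edgeSum_abs_dwave a.1 n a.1.2 (W a.1 a.2)
      rw [hW2] at h2
      have h3 := hrlt a.1
      have h4 : 0 < ((k : ℝ) * m) ^ (a.1 : ℕ) := by positivity
      have h5 : 0 < ((k : ℝ) * m) ^ n := by positivity
      rw [h1, le_div_iff₀ (by positivity)]
      refine le_of_mul_le_mul_left (le_trans ?_ h2) h4
      -- The amplitudes are nonzero on more than half of the copies, which turns `1 / 3` into `1 /
      -- 6`.
      calc _ = ((k : ℝ) * m) ^ n * (1 / 3) * ((k : ℝ) * m) ^ (a.1 : ℕ) := by ring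
        _ ≤ ((k : ℝ) * m) ^ n * (1 / 3) * (2 ^ r a.1 * 2) := by gcongr
        _ = _ := by ring
  · rintro (_ | a)
    · exact G.normLinf_le fun x => by simp [F]
    · exact G.normLinf_le fun x => abs_dwave_le_one _ _ _ (hW1 _ _) _
  · rintro (_ | a) (_ | b) hab
    · exact absurd rfl hab
    · rw [hcomm]
      exact hconst b
    · exact hconst a
    · rcases lt_trichotomy a.1 b.1 with h | h | h
      · rw [hcomm]
        exact hlt a b h
      · obtain ⟨l, a⟩ := a
        obtain ⟨l', b⟩ := b
        obtain rfl : l = l' := h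
        have hab' : a ≠ b := fun h => hab (by rw [h])
        obtain ⟨c, hc⟩ := exists_edgeSum_dwave_mul_dwave (hk := hk) (hm := hm) (l : ℕ) n
        exact hinner (dwave l n (W l a)) (dwave l n (W l b))
          (by rw [hc, hW3 _ _ _ hab', zero_mul])
      · exact hlt b a h
  · intro s hs1 hsk
    -- With `k ^ q ≤ s < k ^ (q + 1)`, the functions of the single level `q - 1` suffice; for `q =
    -- 0` the constant function does.
    obtain ⟨q, hq1, hq2⟩ := exists_nat_pow_near hs1 (by linarith : (1 : ℝ) < k)
    have hsδ : s ^ δ ≤ ((k : ℝ) * m) ^ (q + 1) := by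
      calc s ^ δ ≤ ((k : ℝ) ^ (q + 1)) ^ δ := Real.rpow_le_rpow (by linarith) hq2.le (by linarith)
        _ = _ := by
          rw [← hkδ, ← Real.rpow_natCast, ← Real.rpow_natCast, ← Real.rpow_mul (by linarith),
            ← Real.rpow_mul (by linarith), mul_comm]
    have hcount : ∀ N : ℕ, (2 * (k : ℝ) ^ 2 * (m : ℝ) ^ 2)⁻¹ * s ^ δ ≤ N →
        (N : ℕ∞) ≤ lipGrowth (G.pathMetric _ hℓ) F s →
        ENNReal.ofReal ((2 * (k : ℝ) ^ 2 * (m : ℝ) ^ 2)⁻¹ * s ^ δ) ≤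
          (lipGrowth (G.pathMetric _ hℓ) F s : ℝ≥0∞) := by
      intro N h1 h2
      calc _ ≤ ENNReal.ofReal N := ENNReal.ofReal_le_ofReal h1
        _ = ((N : ℕ∞) : ℝ≥0∞) := by simp
        _ ≤ _ := by exact_mod_cast h2
    rcases q with _ | l
    · refine hcount 1 ?_ ?_
      · rw [inv_mul_le_iff₀ (by positivity)]
        refine hsδ.trans ?_
        have : (1 : ℝ) ≤ k * m := one_le_mul_of_one_le_of_one_le hk1 (by linarith)
        rw [zero_add, pow_one, Nat.cast_one]
        nlinarith
      · have h : lipConst (G.pathMetric _ hℓ) (F none) ≤ s :=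
          G.lipConst_pathMetric_le hℓ (by linarith) fun e => by
            simp only [F, Option.elim_none, sub_self, abs_zero]
            positivity
        calc ((1 : ℕ) : ℕ∞) = Set.encard {(none : Option (Σ l : Fin n, (Fin (r l) → Bool)))} := by
              simp
          _ ≤ _ := Set.encard_le_encard (by simpa using h)
    -- The bandwidth `k ^ n` guarantees that the required level exists.
    · have hln : l < n := by
        have := (pow_le_pow_iff_right₀ (by linarith : (1 : ℝ) < k)).mp (hq1.trans hsk)
        omega
      refine hcount (2 ^ r l) ?_ ?_
      · rw [inv_mul_le_iff₀ (by positivity)]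
        refine hsδ.trans ?_
        have h3 := hrlt l
        push_cast
        -- Two factors `k * m` are lost, one from rounding `s` up to `k ^ (l + 2)` and one because
        -- level `l` has Lipschitz bound `k ^ (l + 1)`; the `2` comes from rounding `(k * m) ^ l` to
        -- a power of two.
        calc ((k : ℝ) * m) ^ (l + 1 + 1) = (k : ℝ) ^ 2 * (m : ℝ) ^ 2 * ((k : ℝ) * m) ^ l := by ring
          _ ≤ (k : ℝ) ^ 2 * (m : ℝ) ^ 2 * (2 ^ r l * 2) := by gcongr
          _ = _ := by ring
      · have hinj : Function.Injective fun a : Fin (r l) → Bool =>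
            (some ⟨⟨l, hln⟩, a⟩ : Option (Σ l : Fin n, (Fin (r l) → Bool))) := by
          intro a b h
          simpa using h
        calc ((2 ^ r l : ℕ) : ℕ∞) = Set.encard (Set.range fun a : Fin (r l) → Bool =>
              (some ⟨⟨l, hln⟩, a⟩ : Option (Σ l : Fin n, (Fin (r l) → Bool)))) := by
              rw [← Set.image_univ, hinj.encard_image, Set.encard_univ]
              simp
          _ ≤ _ := by
              refine Set.encard_le_encard ?_
              rintro _ ⟨a, rfl⟩
              exact (hlip ⟨⟨l, hln⟩, a⟩).trans hq1

end

/-! ### The main theorem -/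

theorem theoremC (k m : ℕ) (hk : 2 ≤ k) (hm : 2 ≤ m) :
    ∃ Ciso C₁ Cinf Cγ : ℝ,
      Ciso ≤ (m : ℝ) / 2 ∧ C₁ ≤ 6 ∧ Cinf ≤ 1 ∧ Cγ ≤ 2 * (k : ℝ) ^ 2 * (m : ℝ) ^ 2 ∧
      ∀ n : ℕ, 1 ≤ n →
        (diamondPow k m hk hm n).HasIsoperimetricDimension
          (diamondPow k m hk hm n).degreeProb (diamondPow k m hk hm n).uniformEdge
          (diamondMetric k m hk hm n)
          (1 + Real.log m / Real.log k) Ciso ∧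
        (diamondPow k m hk hm n).HasLipschitzSpectralProfile
          (diamondPow k m hk hm n).degreeProb (diamondMetric k m hk hm n)
          (1 + Real.log m / Real.log k) ((k : ℝ) ^ n) C₁ Cinf Cγ := by
  refine ⟨(m : ℝ) / 2, 6, 1, 2 * (k : ℝ) ^ 2 * (m : ℝ) ^ 2, le_rfl, le_rfl, le_rfl, le_rfl,
    fun n hn => ?_⟩
  obtain ⟨n, rfl⟩ := Nat.exists_eq_add_of_le' hn
  have φ := (diamond k m hk hm).slashPowIso n
  exact ⟨φ.hasIsoperimetricDimension _, φ.hasLipschitzSpectralProfile _⟩
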